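/- Let $\varphi(x)=\sqrt{1-x^2}$ and let $\|\cdot\|_p$ be the norm of $L_p[-1,1]$, $1\le p\le\infty$ (for $p=\infty$, the essential supremum). For $r\ge 1$ let $\mathbb B_p^r$ be the set of functions $f$ on $(-1,1)$ that are $r-1$ times differentiable, with $f^{(r-1)}$ locally absolutely continuous in $(-1,1)$ and $\|f^{(r)}\varphi^r\|_p<\infty$, where $f^{(r)}$ is the almost everywhere defined derivative of $f^{(r-1)}$; let $\mathbb B_p^0=L_p[-1,1]$. For $k\in\mathbb N$ and $h\ge 0$ put $$\Delta_h^k(g,x)=\sum_{i=0}^k\binom ki(-1)^{k-i}g\bigl(x+(i-k/2)h\bigr)\quad\text{if } x\pm kh/2\in[-1,1],\qquad \Delta_h^k(g,x)=0\quad\text{otherwise},$$ $$\mathcal W_\delta(x)=\bigl((1-x-\delta\varphi(x)/2)(1+x-\delta\varphi(x)/2)\bigr)^{1/2},$$ and, for $f\in\mathbb B_p^r$ and $t>0$, $$\omega_{k,r}^\varphi(f^{(r)},t)_p=\sup_{0\le h\le t}\bigl\|\mathcal W_{kh}^r(\cdot)\,\Delta^k_{h\varphi(\cdot)}(f^{(r)},\cdot)\bigr\|_p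 ,$$ where the function inside the norm is understood to be $0$ at every $x$ at which the difference is $0$ by definition. Let $k\ge 1$ and $r\ge 0$ be integers and $1\le p\le\infty$. Then there is a constant $c>0$, depending only on $k$, $r$ and $p$, such that for all $f\in\mathbb B_p^r$, all $\lambda\ge 1$ and all $t>0$ the modulus $\omega_{k,r}^\varphi(f^{(r)},t)_p$ is finite and $$\omega_{k,r}^\varphi(f^{(r)},\lambda t)_p\le c\,\lambda^k\,\omega_{k,r}^\varphi(f^{(r)},t)_p .$$ -/

import Mathlib

open MeasureTheory
open scoped ENNReal

noncomputable section

namespace DTModulus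

/-- Lebesgue measure on `[-1, 1]`; `eLpNorm g p leb` is the norm of `g` in `L_p[-1,1]`. -/
def leb : Measure ℝ := volume.restrict (Set.Icc (-1) 1)

/-- `φ(x) = √(1 - x²)`. -/
def phi (x : ℝ) : ℝ := Real.sqrt (1 - x ^ 2)

open Classical in
/-- The `k`-th symmetric difference `Δ_h^k(f, x)` relative to `[-1, 1]`; it is `0` unless
`x - kh/2` and `x + kh/2` both lie in `[-1, 1]`. -/
def symDiff (k : ℕ) (h : ℝ) (f : ℝ → ℝ) (x : ℝ) : ℝ :=
  if x - k * h / 2 ∈ Set.Icc (-1 : ℝ) 1 ∧ x + k * h / 2 ∈ Set.Icc (-1 : ℝ) 1 then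
    ∑ i ∈ Finset.range (k + 1),
      (k.choose i : ℝ) * (-1) ^ (k - i) * f (x + ((i : ℝ) - (k : ℝ) / 2) * h)
  else 0

/-- The weight `𝒲_δ(x) = ((1 - x - δφ(x)/2)(1 + x - δφ(x)/2))^{1/2}`. It is only ever multiplied
by a difference that vanishes (for almost every `x`) unless both factors are nonnegative. -/
def weight (δ x : ℝ) : ℝ :=
  Real.sqrt ((1 - x - δ * phi x / 2) * (1 + x - δ * phi x / 2))

/-- `g ∈ AC_loc(-1, 1)`: `g` is absolutely continuous on every `[a, b] ⊆ (-1, 1)`. -/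
def LocallyAC (g : ℝ → ℝ) : Prop :=
  ∀ a b : ℝ, -1 < a → a ≤ b → b < 1 → AbsolutelyContinuousOnInterval g a b

/-- The class `𝔹_p^r`. For `r ≥ 1` the function `f` is `r - 1` times continuously differentiable
on `(-1, 1)`, `f^(r-1) ∈ AC_loc(-1, 1)`, and `f^(r) φ^r ∈ L_p[-1,1]`, where `f^(r)` is the
derivative of `f^(r-1)`, which exists almost everywhere. Moreover `𝔹_p^0 = L_p[-1,1]`. -/
def MemB (p : ℝ≥0∞) : ℕ → (ℝ → ℝ) → Prop
  | 0, f => MemLp f p leb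
  | r + 1, f =>
      ContDiffOn ℝ (r : ℕ) f (Set.Ioo (-1) 1) ∧
      LocallyAC (iteratedDeriv r f) ∧
      MemLp (fun x => iteratedDeriv (r + 1) f x * phi x ^ (r + 1)) p leb

/-- The modulus `ω_{k,r}^φ(g, t)_p = sup_{0 ≤ h ≤ t} ‖𝒲_{kh}^r Δ_{hφ}^k(g, ·)‖_p`, as an extended
nonnegative real (here `g` stands for `f^(r)`). -/
def modulus (k r : ℕ) (p : ℝ≥0∞) (g : ℝ → ℝ) (t : ℝ) : ℝ≥0∞ :=
  ⨆ h ∈ Set.Icc (0 : ℝ) t,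
    eLpNorm (fun x => weight (k * h) x ^ r * symDiff k (h * phi x) g x) p leb

end DTModulus

end

namespace DTModulus

/-! The classical identity writes a `k`-th difference with step `ns` as a sum of `n^k` differences
with step `s`. Here the step `Hφ(x)` depends on `x`, so the pieces have steps adapted to `φ` at `x`
and not at their own nodes; near `±1` such a step can be far too long. Two devices repair this.

Local averages. Call a step admissible at its endmost node `z` if it is small against `t(√(1-z)+t)`
(`StepOK`). A difference with admissible step `σ` is bounded through differences with steps `ls` and
`σ+ls` (`fdiff_swap`), and averaging over the free parameter `s` bounds it pointwise by values of
`energy` (`rpow_fdiff_le_energy`). In the integral of `energy`, passing to the midpoint `w = z -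
ks/2` and substituting `s = uφ(w)` produces the mean over `0 < u ≤ t` of the `q`-th powers of the
norms that define the modulus (`lintegral_energy_le`). The maps `x ↦ x + γφ(x)`, which carry `x` to
the nodes, distort measure by a factor at most 2 (`map_shift_le`), and the left half of the interval
follows by reflection. So each admissible piece has norm at most a constant times the modulus at `t`
(`eLpNorm_block_le`), with a constant independent of the exponent `q`.

Counting. Take `n` of order `λ`. A piece whose outer node is `q` small steps away from an end of the
stencil is cut again into `m^k` pieces, `m` about `√(kn/q)` (about `n` if `q = 0`); this makes it
admissible (`stepOK_of_cutSize_le`). Since `∑ i^(-1/2)` up to `n` is at most `2√n`, the total number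
of pieces is still `O(n^k)` (`sum_cutSize_pow_le`), which gives the factor `λ^k`.

The case `p = ∞` follows by letting `q → ∞`, and large `t` is reduced to `t ≤ 1` because the
differences vanish once `H > 2`. -/

/-! ### Finite differences with constant step. -/

/-- The `k`-th forward difference with step `s` (of any sign) at `y`. -/
noncomputable def fdiff (k : ℕ) (s : ℝ) (F : ℝ → ℝ) (y : ℝ) : ℝ :=
  ∑ i ∈ Finset.range (k + 1), (k.choose i : ℝ) * (-1) ^ (k - i) * F (y + i * s)

lemma fdiff_eq_iterate (k : ℕ) (s : ℝ) (F : ℝ → ℝ) (y : ℝ) :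
    fdiff k s F y = (fwdDiff s)^[k] F y := by
  rw [fwdDiff_iter_eq_sum_shift, fdiff]
  refine Finset.sum_congr rfl fun i _ => ?_
  simp only [nsmul_eq_mul, zsmul_eq_mul]
  push_cast
  ring

lemma symDiff_eq_fdiff {k : ℕ} {s : ℝ} {F : ℝ → ℝ} {w : ℝ}
    (h1 : w - k * s / 2 ∈ Set.Icc (-1 : ℝ) 1) (h2 : w + k * s / 2 ∈ Set.Icc (-1 : ℝ) 1) :
    symDiff k s F w = fdiff k s F (w - k * s / 2) := by
  rw [symDiff, if_pos ⟨h1, h2⟩, fdiff]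
  refine Finset.sum_congr rfl fun i _ => ?_
  congr 2
  ring

lemma fdiff_neg (k : ℕ) (s : ℝ) (F : ℝ → ℝ) (y : ℝ) :
    fdiff k (-s) F (y + k * s) = (-1) ^ k * fdiff k s F y := by
  rw [fdiff, fdiff, ← Finset.sum_range_reflect, Finset.mul_sum]
  refine Finset.sum_congr rfl fun i hi => ?_
  have hi' : i ≤ k := by simpa [Nat.lt_succ_iff] using hi
  have e1 : k + 1 - 1 - i = k - i := by omega
  rw [e1, Nat.choose_symm hi', Nat.sub_sub_self hi', Nat.cast_sub hi']
  have e2 : (-1 : ℝ) ^ k * (-1) ^ (k - i) = (-1) ^ i := by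
    obtain ⟨m, rfl⟩ := Nat.exists_eq_add_of_le hi'
    rw [Nat.add_sub_cancel_left, pow_add, mul_assoc, ← pow_add, ← two_mul, pow_mul]
    simp
  rw [← e2]
  have e3 : y + k * s + (k - i : ℝ) * -s = y + i * s := by ring
  rw [e3]
  ring

lemma abs_fdiff_neg (k : ℕ) (s : ℝ) (F : ℝ → ℝ) (y : ℝ) :
    |fdiff k (-s) F (y + k * s)| = |fdiff k s F y| := by
  rw [fdiff_neg, abs_mul]
  simp

lemma fdiff_reflect (k : ℕ) (s : ℝ) (F : ℝ → ℝ) (y : ℝ) :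
    fdiff k s (fun x => F (-x)) y = fdiff k (-s) F (-y) := by
  unfold fdiff
  refine Finset.sum_congr rfl fun i _ => ?_
  dsimp only
  congr 2
  ring

lemma fdiff_zero {k : ℕ} (hk : 1 ≤ k) (F : ℝ → ℝ) (y : ℝ) : fdiff k 0 F y = 0 := by
  obtain ⟨m, rfl⟩ := Nat.exists_eq_add_of_le' hk
  rw [fdiff_eq_iterate, Function.iterate_succ_apply]
  have : fwdDiff (0 : ℝ) F = 0 := by
    ext x
    simp [fwdDiff]
  rw [this]
  have h : ∀ m : ℕ, (fwdDiff (0 : ℝ))^[m] (0 : ℝ → ℝ) = 0 := by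
    intro m
    induction m with
    | zero => rfl
    | succ m ih =>
      rw [Function.iterate_succ_apply', ih]
      ext x
      simp [fwdDiff]
  rw [h]
  rfl

/-- Both sides are the same double sum over the nodes `z + i(σ + ls) = (z + iσ) + l(is)`, summed in
the two orders. -/
lemma fdiff_swap (k : ℕ) (σ s : ℝ) (F : ℝ → ℝ) (z : ℝ) :
    ∑ l ∈ Finset.range (k + 1), (k.choose l : ℝ) * (-1) ^ (k - l) * fdiff k (σ + l * s) F z =
    ∑ l ∈ Finset.range (k + 1), (k.choose l : ℝ) * (-1) ^ (k - l) * fdiff k (l * s) F (z + l * σ) := by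
  simp only [fdiff, Finset.mul_sum]
  rw [Finset.sum_comm]
  refine Finset.sum_congr rfl fun i _ => Finset.sum_congr rfl fun j _ => ?_
  have : z + i * (σ + j * s) = z + i * σ + j * (i * s) := by ring
  rw [this]
  ring

/-- A difference with step `σ` is controlled by differences with steps `l s` and `σ + l s`. -/
lemma abs_fdiff_le {k : ℕ} (hk : 1 ≤ k) (σ s : ℝ) (F : ℝ → ℝ) (z : ℝ) :
    |fdiff k σ F z| ≤ ∑ l ∈ Finset.Icc 1 k, (k.choose l : ℝ) *
      (|fdiff k (l * s) F (z + l * σ)| + |fdiff k (σ + l * s) F z|) := by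
  have h := fdiff_swap k σ s F z
  have hr : Finset.range (k + 1) = insert 0 (Finset.Icc 1 k) := by
    ext i
    simp
    omega
  -- The term `l = 0` is the wanted difference on the left and a difference with step 0, hence zero,
  -- on the right.
  rw [hr, Finset.sum_insert (by simp), Finset.sum_insert (by simp)] at h
  simp only [Nat.choose_zero_right, Nat.cast_one, Nat.sub_zero, one_mul, Nat.cast_zero, zero_mul,
    add_zero, fdiff_zero hk, mul_zero, zero_add] at h
  have h2 : (-1) ^ k * fdiff k σ F z = ∑ l ∈ Finset.Icc 1 k, ((k.choose l : ℝ) * (-1) ^ (k - l) *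
      (fdiff k (l * s) F (z + l * σ) - fdiff k (σ + l * s) F z)) := by
    simp only [mul_sub, Finset.sum_sub_distrib]
    linarith
  have h3 : |fdiff k σ F z| = |(-1) ^ k * fdiff k σ F z| := by
    rw [abs_mul]
    simp
  rw [h3, h2]
  refine (Finset.abs_sum_le_sum_abs _ _).trans (Finset.sum_le_sum fun l _ => ?_)
  rw [abs_mul, abs_mul, abs_pow, abs_neg, abs_one, one_pow, mul_one, Nat.abs_cast]
  gcongr
  exact abs_sub _ _

/-- Induction on the order: a first difference with step `ns` telescopes into `n` first differences
with step `s`. -/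
lemma fdiff_subdivide (k n : ℕ) (s : ℝ) (F : ℝ → ℝ) (y : ℝ) :
    fdiff k (n * s) F y =
      ∑ j : Fin k → Fin n, fdiff k s F (y + ((∑ i, (j i : ℕ) : ℕ) : ℝ) * s) := by
  simp only [fdiff_eq_iterate]
  induction k generalizing y with
  | zero => simp
  | succ k ih =>
    rw [Function.iterate_succ_apply', fwdDiff, ih, ih, ← Finset.sum_sub_distrib]
    rw [← (Fin.consEquiv fun _ : Fin (k + 1) => Fin n).sum_comp, Fintype.sum_prod_type,
      Finset.sum_comm]
    refine Finset.sum_congr rfl fun j _ => ?_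
    set K := (fwdDiff s)^[k] F with hK
    set u : ℝ := ((∑ i, (j i : ℕ) : ℕ) : ℝ) * s with hu
    have ht := Finset.sum_range_sub (fun i : ℕ => K (y + u + i * s)) n
    have e1 : y + n * s + u = y + u + n * s := by ring
    rw [e1]
    simp only [Nat.cast_zero, zero_mul, add_zero] at ht
    rw [← ht, ← Fin.sum_univ_eq_sum_range (fun i => K (y + u + ((i + 1 : ℕ) : ℝ) * s) -
      K (y + u + (i : ℝ) * s))]
    refine Finset.sum_congr rfl fun i _ => ?_
    rw [Function.iterate_succ_apply', ← hK, fwdDiff]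
    congr 2
    · simp [Fin.consEquiv, Fin.sum_univ_succ, hu]
      ring
    · simp [Fin.consEquiv, Fin.sum_univ_succ, hu]
      ring

lemma measurable_fdiff (k : ℕ) {F : ℝ → ℝ} (hF : Measurable F) :
    Measurable fun v : ℝ × ℝ => fdiff k v.1 F v.2 := by
  unfold fdiff
  fun_prop

/-! ### Counting the pieces. -/

lemma sum_inv_sqrt_le (n : ℕ) : ∑ i ∈ Finset.range n, 1 / √((i : ℝ) + 1) ≤ 2 * √n := by
  induction n with
  | zero => simp
  | succ n ih =>
    rw [Finset.sum_range_succ]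
    push_cast
    have h1 : 0 < √((n : ℝ) + 1) := by positivity
    have h2 := Real.sq_sqrt (show (0 : ℝ) ≤ n by positivity)
    have h3 := Real.sq_sqrt (show (0 : ℝ) ≤ (n : ℝ) + 1 by positivity)
    have h4 : 1 / √((n : ℝ) + 1) ≤ 2 * √((n : ℝ) + 1) - 2 * √n := by
      rw [div_le_iff₀ h1]
      nlinarith [sq_nonneg (√((n : ℝ) + 1) - √n)]
    linarith

/-- The number of pieces into which a block at distance `q` from the end of `n` blocks is cut. -/
noncomputable def cutSize (k n q : ℕ) : ℝ := if q = 0 then n else √(k * n / q)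

/-- Only `j = 0` has `q = 0`, and it contributes `n^k`. Otherwise `q ≥ 1` and `q ≥ j i` give `j i +
1 ≤ 2q`, so each of the `k` factors `√(kn/q)` can be charged to its own coordinate; the sum of the
products is then a `k`-th power of a one-dimensional sum. -/
lemma sum_cutSize_pow_le {k : ℕ} (hk : 1 ≤ k) (n : ℕ) :
    ∑ j : Fin k → Fin n, cutSize k n (∑ i, (j i : ℕ)) ^ k ≤
      (1 + (2 * √(2 * k)) ^ k) * (n : ℝ) ^ k := by
  have hk0 : (0 : ℝ) < k := by exact_mod_cast hk
  have key : ∀ j : Fin k → Fin n, cutSize k n (∑ i, (j i : ℕ)) ^ k ≤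
      (if ∀ i, (j i : ℕ) = 0 then (n : ℝ) ^ k else 0) +
        ∏ i, (√(2 * k) * √n * (1 / √(((j i : ℕ) : ℝ) + 1))) := by
    intro j
    by_cases h0 : ∑ i, (j i : ℕ) = 0
    · have h0' : ∀ i, (j i : ℕ) = 0 := by simpa using h0
      rw [cutSize, if_pos h0, if_pos h0']
      have : 0 ≤ ∏ i, (√(2 * k) * √n * (1 / √(((j i : ℕ) : ℝ) + 1))) :=
        Finset.prod_nonneg fun i _ => by positivity
      linarith
    · have h0' : ¬ ∀ i, (j i : ℕ) = 0 := by simpa using h0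
      rw [cutSize, if_neg h0, if_neg h0', zero_add]
      have hc : √(k * n / (∑ i, (j i : ℕ) : ℕ)) ^ k =
          ∏ _i : Fin k, √(k * n / (∑ i, (j i : ℕ) : ℕ)) := by simp
      rw [hc]
      refine Finset.prod_le_prod (fun i _ => Real.sqrt_nonneg _) fun i _ => ?_
      rw [mul_one_div, ← Real.sqrt_mul (by positivity), ← Real.sqrt_div (by positivity)]
      apply Real.sqrt_le_sqrt
      have hle : (j i : ℕ) ≤ ∑ i, (j i : ℕ) :=
        Finset.single_le_sum (f := fun i => (j i : ℕ)) (fun _ _ => Nat.zero_le _)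
          (Finset.mem_univ i)
      generalize (∑ i, (j i : ℕ)) = q at *
      have hq : (0 : ℝ) < q := by exact_mod_cast Nat.pos_of_ne_zero h0
      have hq1 : (1 : ℝ) ≤ q := by exact_mod_cast Nat.pos_of_ne_zero h0
      have hle' : ((j i : ℕ) : ℝ) ≤ q := by exact_mod_cast hle
      rw [div_le_div_iff₀ hq (by positivity)]
      have : (0 : ℝ) ≤ k * n := by positivity
      nlinarith
  refine (Finset.sum_le_sum fun j _ => key j).trans ?_
  rw [Finset.sum_add_distrib, add_mul, one_mul]
  refine add_le_add ?_ ?_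
  · rw [← Finset.sum_filter, Finset.sum_const, nsmul_eq_mul]
    have : (Finset.univ.filter fun j : Fin k → Fin n => ∀ i, (j i : ℕ) = 0).card ≤ 1 := by
      refine Finset.card_le_one.2 fun a ha b hb => ?_
      simp only [Finset.mem_filter, Finset.mem_univ, true_and] at ha hb
      ext i
      rw [ha i, hb i]
    calc _ ≤ (1 : ℝ) * (n : ℝ) ^ k := by
          gcongr
          exact_mod_cast this
      _ = _ := one_mul _
  · have h := Finset.prod_univ_sum (fun _ : Fin k => (Finset.univ : Finset (Fin n)))
      (fun _ m => √(2 * k) * √n * (1 / √(((m : ℕ) : ℝ) + 1)))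
    rw [Fintype.piFinset_univ] at h
    rw [← h, Finset.prod_const, Finset.card_univ, Fintype.card_fin, ← mul_pow]
    refine pow_le_pow_left₀ (Finset.sum_nonneg fun _ _ => by positivity) ?_ k
    rw [← Finset.mul_sum, Fin.sum_univ_eq_sum_range (fun i => 1 / √((i : ℝ) + 1))]
    calc _ ≤ √(2 * k) * √n * (2 * √n) := by gcongr; exact sum_inv_sqrt_le n
      _ = 2 * √(2 * k) * (√n * √n) := by ring
      _ = _ := by rw [Real.mul_self_sqrt (by positivity)]

/-! ### The maps `x ↦ x + αφ(x)`. -/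

lemma phi_nonneg (x : ℝ) : 0 ≤ phi x := Real.sqrt_nonneg _

lemma phi_sq {x : ℝ} (hx : |x| ≤ 1) : phi x ^ 2 = 1 - x ^ 2 := by
  have := (sq_le_one_iff_abs_le_one x).2 hx
  exact Real.sq_sqrt (by linarith)

lemma measurable_phi : Measurable phi := by
  unfold phi
  fun_prop

/-- The points `x ∈ (-1, 1)` with `x ± a φ(x) ∈ [-1, 1]`. -/
def dom (a : ℝ) : Set ℝ := {x | |x| < 1 ∧ a * phi x ≤ 1 - |x|}

lemma measurableSet_dom (a : ℝ) : MeasurableSet (dom a) := by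
  have := measurable_phi
  have h : Measurable fun x : ℝ => |x| := by fun_prop
  exact (measurableSet_lt h measurable_const).inter
    (measurableSet_le (by fun_prop : Measurable fun x => a * phi x) (measurable_const.sub h))

lemma dom_subset (a : ℝ) : dom a ⊆ Set.Icc (-1) 1 := fun _ hx => abs_le.1 hx.1.le

lemma shift_mem {a α x : ℝ} (hα : |α| ≤ a) (hx : x ∈ dom a) :
    x + α * phi x ∈ Set.Icc (-1 : ℝ) 1 := by
  have h1 := hx.2
  have h2 := abs_le.1 hα
  have h3 := phi_nonneg x
  have h4 := neg_abs_le x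
  have h5 := le_abs_self x
  constructor <;> nlinarith

/-- Multiplying `aφ ≤ 1 - |x|` by `φ` and cancelling `1 - |x|` gives `a(1 + |x|) ≤ φ`. The meaning
is that `aφ` has slope at most `1/2` on `dom a`. -/
lemma two_mul_le_phi {a x : ℝ} (ha : 0 ≤ a) (hx : x ∈ dom a) : 2 * (a * |x|) ≤ phi x := by
  obtain ⟨h1, h2⟩ := hx
  have h3 := phi_nonneg x
  have h4 := phi_sq h1.le
  have h5 : x ^ 2 = |x| ^ 2 := (sq_abs x).symm
  have h6 : (1 - |x|) * (a * (1 + |x|)) ≤ (1 - |x|) * phi x := by nlinarith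
  have h7 := le_of_mul_le_mul_left h6 (by linarith)
  nlinarith [abs_nonneg x]

/-- On `(-1, 1)` one has `φ(x) ≥ 1 - |x| > 0`. This is what makes all large steps irrelevant. -/
lemma dom_one_le {a x : ℝ} (ha : 0 ≤ a) (hx : x ∈ dom a) : a ≤ 1 := by
  by_contra! h
  have h0 := abs_nonneg x
  have h1 : phi x ≤ 1 - |x| ∧ 0 < phi x := by
    obtain ⟨h1, h2⟩ := hx
    have h3 := phi_nonneg x
    have h4 := phi_sq h1.le
    have h5 : x ^ 2 = |x| ^ 2 := (sq_abs x).symm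
    refine ⟨by nlinarith, ?_⟩
    apply lt_of_le_of_ne h3
    intro h6
    rw [← h6] at h4
    nlinarith
  have h4 := phi_sq hx.1.le
  have h5 : x ^ 2 = |x| ^ 2 := (sq_abs x).symm
  have := hx.2
  nlinarith [hx.1]

/-- The perturbation `αφ` is `1/2`-Lipschitz on `dom a`. Factoring `φ(x)² - φ(y)² = -(x - y)(x + y)`
avoids derivatives and any convexity of the domain. -/
lemma shift_antilipschitz {a α x y : ℝ} (hα : |α| ≤ a) (hx : x ∈ dom a) (hy : y ∈ dom a) :
    |x - y| ≤ 2 * |(x + α * phi x) - (y + α * phi y)| := by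
  have ha : 0 ≤ a := (abs_nonneg α).trans hα
  have hx2 := two_mul_le_phi ha hx
  have hy2 := two_mul_le_phi ha hy
  have h1 := phi_sq hx.1.le
  have h2 := phi_sq hy.1.le
  have hxp : 0 < phi x := by
    refine lt_of_le_of_ne (phi_nonneg x) fun h => ?_
    rw [← h] at h1
    have := hx.1
    have h5 : x ^ 2 = |x| ^ 2 := (sq_abs x).symm
    nlinarith [abs_nonneg x]
  have hyp := phi_nonneg y
  have key : |α * (phi x - phi y)| ≤ |x - y| / 2 := by
    refine le_of_mul_le_mul_right ?_ (add_pos_of_pos_of_nonneg hxp hyp)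
    have e : |α * (phi x - phi y)| * (phi x + phi y) = |α| * (|x - y| * |x + y|) := by
      rw [← abs_of_nonneg (add_nonneg hxp.le hyp), ← abs_mul, ← abs_mul, ← abs_mul,
        ← abs_neg (α * ((x - y) * (x + y)))]
      congr 1
      linear_combination α * h1 - α * h2
    rw [e]
    have h3 : |x + y| ≤ |x| + |y| := abs_add_le x y
    calc |α| * (|x - y| * |x + y|) ≤ a * (|x - y| * (|x| + |y|)) := by gcongr
      _ = |x - y| * (a * |x| + a * |y|) := by ring
      _ ≤ |x - y| * ((phi x + phi y) / 2) := by gcongr; linarith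
      _ = _ := by ring
  have h4 : x - y = ((x + α * phi x) - (y + α * phi y)) - α * (phi x - phi y) := by ring
  have h5 : |x - y| ≤ |(x + α * phi x) - (y + α * phi y)| + |α * (phi x - phi y)| := by
    conv_lhs => rw [h4]
    exact abs_sub _ _
  linarith

lemma measurable_shift (α : ℝ) : Measurable fun x => x + α * phi x := by
  have := measurable_phi
  fun_prop

/-- Lebesgue measure is one-dimensional Hausdorff measure, for which an antilipschitz bound controls
preimages directly. -/
lemma volume_shift_preimage_le {a α : ℝ} (hα : |α| ≤ a) (s : Set ℝ) :
    volume ((fun x => x + α * phi x) ⁻¹' s ∩ dom a) ≤ 2 * volume s := by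
  let f : dom a → ℝ := fun x => x + α * phi x
  have hf : AntilipschitzWith 2 f := AntilipschitzWith.of_le_mul_dist fun x y => by
    simpa [f, Subtype.dist_eq, Real.dist_eq] using shift_antilipschitz hα x.2 y.2
  have h := hf.hausdorffMeasure_preimage_le zero_le_one s
  rw [← isometry_subtype_coe.hausdorffMeasure_image (Or.inl zero_le_one)] at h
  rw [hausdorffMeasure_real] at h
  have e : (Subtype.val '' (f ⁻¹' s)) = (fun x => x + α * phi x) ⁻¹' s ∩ dom a := by
    ext x
    simp [f]
  rw [e] at h
  simpa using h

lemma map_shift_le {a α : ℝ} (hα : |α| ≤ a) :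
    (volume.restrict (dom a)).map (fun x => x + α * phi x) ≤ (2 : ℝ≥0∞) • leb := by
  refine Measure.le_iff.2 fun s hs => ?_
  rw [Measure.map_apply (measurable_shift α) hs,
    Measure.restrict_apply (measurable_shift α hs), Measure.smul_apply, leb,
    Measure.restrict_apply hs, smul_eq_mul]
  refine le_trans (measure_mono ?_) (volume_shift_preimage_le hα _)
  exact fun x hx => ⟨⟨hx.1, shift_mem hα hx.2⟩, hx.2⟩

lemma map_shift_ac {a α : ℝ} (hα : |α| ≤ a) :
    (volume.restrict (dom a)).map (fun x => x + α * phi x) ≪ leb :=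
  (Measure.absolutelyContinuous_of_le (map_shift_le hα)).trans
    (Measure.smul_absolutelyContinuous)

lemma lintegral_shift_le {a α : ℝ} (hα : |α| ≤ a) {G : ℝ → ℝ≥0∞} (hG : Measurable G) :
    ∫⁻ x in dom a, G (x + α * phi x) ≤ 2 * ∫⁻ z in Set.Icc (-1) 1, G z := by
  rw [← lintegral_map hG (measurable_shift α)]
  refine (lintegral_mono' (map_shift_le hα) le_rfl).trans ?_
  rw [lintegral_smul_measure, leb, smul_eq_mul]

/-! ### The modulus as a norm over `dom`, and its finiteness. -/

lemma weight_eq (k : ℕ) (h x : ℝ) : weight (k * h) x =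
    √((1 - (x + k * h / 2 * phi x)) * (1 + (x - k * h / 2 * phi x))) := by
  rw [weight]
  congr 1
  ring

/-- The function under the norm in the modulus. -/
noncomputable def wdiff (k r : ℕ) (h : ℝ) (F : ℝ → ℝ) (x : ℝ) : ℝ :=
  weight (k * h) x ^ r * fdiff k (h * phi x) F (x - k * h / 2 * phi x)

lemma eLpNorm_symDiff_eq {k : ℕ} (hk : 1 ≤ k) (r : ℕ) {h : ℝ} (hh : 0 ≤ h) (F : ℝ → ℝ)
    (p : ℝ≥0∞) :
    eLpNorm (fun x => weight (k * h) x ^ r * symDiff k (h * phi x) F x) p leb =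
      eLpNorm (wdiff k r h F) p (volume.restrict (dom (k * h / 2))) := by
  have e : (fun x => weight (k * h) x ^ r * symDiff k (h * phi x) F x) =ᵐ[leb]
      (dom (k * h / 2)).indicator (wdiff k r h F) := by
    have hne : ∀ᵐ x ∂leb, x ≠ 1 ∧ x ≠ -1 := by
      have : ∀ᵐ x ∂(volume : Measure ℝ), x ≠ 1 ∧ x ≠ -1 :=
        (Measure.ae_ne volume 1).and (Measure.ae_ne volume (-1))
      exact ae_restrict_of_ae this
    have hmem : ∀ᵐ x ∂leb, x ∈ Set.Icc (-1 : ℝ) 1 := ae_restrict_mem measurableSet_Icc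
    filter_upwards [hne, hmem] with x hx hx2
    have habs : |x| < 1 := abs_lt.2
      ⟨lt_of_le_of_ne hx2.1 (Ne.symm hx.2), lt_of_le_of_ne hx2.2 hx.1⟩
    have hp := phi_nonneg x
    have hk0 : (0 : ℝ) ≤ k := k.cast_nonneg
    have e1 : (k : ℝ) * (h * phi x) / 2 = k * h / 2 * phi x := by ring
    have hpos : 0 ≤ k * h / 2 * phi x := by positivity
    by_cases hd : x ∈ dom (k * h / 2)
    · rw [Set.indicator_of_mem hd, wdiff, symDiff_eq_fdiff, e1]
      · rw [e1]
        have := hd.2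
        have h4 := neg_abs_le x
        have h5 := le_abs_self x
        constructor <;> linarith
      · rw [e1]
        have := hd.2
        have h4 := neg_abs_le x
        have h5 := le_abs_self x
        constructor <;> linarith
    · rw [Set.indicator_of_notMem hd, symDiff, if_neg, mul_zero]
      rintro ⟨h1, h2⟩
      rw [e1] at h1 h2
      apply hd
      refine ⟨habs, ?_⟩
      rcases abs_cases x with hx | hx <;> linarith [h1.1, h2.2, hx.1]
  rw [eLpNorm_congr_ae e, eLpNorm_indicator_eq_eLpNorm_restrict (measurableSet_dom _), leb,
    Measure.restrict_restrict (measurableSet_dom _),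
    Set.inter_eq_left.2 (dom_subset _)]

lemma modulus_eq {k : ℕ} (hk : 1 ≤ k) (r : ℕ) (p : ℝ≥0∞) (F : ℝ → ℝ) (t : ℝ) :
    modulus k r p F t = ⨆ h ∈ Set.Icc (0 : ℝ) t,
      eLpNorm (wdiff k r h F) p (volume.restrict (dom (k * h / 2))) := by
  unfold modulus
  refine iSup_congr fun h => iSup_congr fun hh => ?_
  rw [eLpNorm_symDiff_eq hk r hh.1]

lemma wdiff_eq_sum (k r : ℕ) (h : ℝ) (F : ℝ → ℝ) (x : ℝ) : wdiff k r h F x =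
    ∑ i ∈ Finset.range (k + 1), (k.choose i : ℝ) * (-1) ^ (k - i) *
      (weight (k * h) x ^ r * F (x + (i * h - k * h / 2) * phi x)) := by
  rw [wdiff, fdiff, Finset.mul_sum]
  refine Finset.sum_congr rfl fun i _ => ?_
  have : x - k * h / 2 * phi x + i * (h * phi x) = x + (i * h - k * h / 2) * phi x := by ring
  rw [this]
  ring

lemma abs_shift_coeff_le {k i : ℕ} (hi : i ≤ k) {h : ℝ} (hh : 0 ≤ h) :
    |(i * h - k * h / 2 : ℝ)| ≤ k * h / 2 := by
  have : (i : ℝ) ≤ k := by exact_mod_cast hi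
  have h0 : (0 : ℝ) ≤ i := i.cast_nonneg
  rw [abs_le]
  constructor <;> nlinarith

/-- Null sets pull back to null sets under each node map. This permits replacing `f^(r)` by a
measurable representative. -/
lemma modulus_congr {k : ℕ} (hk : 1 ≤ k) (r : ℕ) (p : ℝ≥0∞) {F G : ℝ → ℝ} (hFG : F =ᵐ[leb] G)
    (t : ℝ) : modulus k r p F t = modulus k r p G t := by
  rw [modulus_eq hk, modulus_eq hk]
  refine iSup_congr fun h => iSup_congr fun hh => eLpNorm_congr_ae ?_
  have : ∀ i ∈ Finset.range (k + 1), ∀ᵐ x ∂(volume.restrict (dom (k * h / 2))),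
      F (x + (i * h - k * h / 2) * phi x) = G (x + (i * h - k * h / 2) * phi x) := by
    intro i hi
    have hi' : i ≤ k := by simpa [Nat.lt_succ_iff] using hi
    exact ae_of_ae_map (measurable_shift _).aemeasurable
      ((map_shift_ac (abs_shift_coeff_le hi' hh.1)).ae_le hFG)
  have := (Finset.eventually_all _).2 this
  filter_upwards [this] with x hx
  rw [wdiff_eq_sum, wdiff_eq_sum]
  exact Finset.sum_congr rfl fun i hi => by rw [hx i hi]

/-- The weight pairs the distances of the extreme nodes to the nearest ends, which are the smallest
over the stencil. Hence each term of the difference is dominated by `Fφ^r` at its own node. -/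
lemma weight_le_phi {k : ℕ} {h α x : ℝ} (hα : |α| ≤ k * h / 2) (hx : x ∈ dom (k * h / 2)) :
    weight (k * h) x ≤ phi (x + α * phi x) := by
  rw [weight_eq]
  change _ ≤ √(1 - (x + α * phi x) ^ 2)
  apply Real.sqrt_le_sqrt
  have h1 := hx.2
  have h2 := abs_le.1 hα
  have h3 := phi_nonneg x
  have h4 := neg_abs_le x
  have h5 := le_abs_self x
  have h6 : 0 ≤ 1 - (x + k * h / 2 * phi x) := by linarith
  have h7 : 0 ≤ 1 + (x - k * h / 2 * phi x) := by linarith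
  have h8 : 1 - (x + k * h / 2 * phi x) ≤ 1 - (x + α * phi x) := by nlinarith
  have h9 : 1 + (x - k * h / 2 * phi x) ≤ 1 + (x + α * phi x) := by nlinarith
  calc _ ≤ (1 - (x + α * phi x)) * (1 + (x + α * phi x)) := by gcongr; exact h6.trans h8
    _ = _ := by ring

lemma weight_nonneg (δ x : ℝ) : 0 ≤ weight δ x := Real.sqrt_nonneg _

lemma measurable_weight (δ : ℝ) : Measurable (weight δ) := by
  have := measurable_phi
  unfold weight
  fun_prop

lemma measurable_wdiff (k r : ℕ) (h : ℝ) {F : ℝ → ℝ} (hF : Measurable F) :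
    Measurable (wdiff k r h F) := by
  have h1 := measurable_phi
  have h2 := measurable_weight (k * h)
  have h3 : Measurable fun x => fdiff k (h * phi x) F (x - k * h / 2 * phi x) :=
    (measurable_fdiff k hF).comp (f := fun x => (h * phi x, x - k * h / 2 * phi x)) (by fun_prop)
  unfold wdiff
  fun_prop

lemma modulus_lt_top {k : ℕ} (hk : 1 ≤ k) (r : ℕ) {p : ℝ≥0∞} (hp : 1 ≤ p) {F : ℝ → ℝ}
    (hF : Measurable F) (hFp : MemLp (fun x => F x * phi x ^ r) p leb) (t : ℝ) :
    modulus k r p F t < ⊤ := by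
  set N := eLpNorm (fun x => F x * phi x ^ r) p ((2 : ℝ≥0∞) • leb) with hN
  have hNtop : N < ⊤ := (hFp.smul_measure (by simp : (2 : ℝ≥0∞) ≠ ⊤)).2
  refine lt_of_le_of_lt (b := ∑ i ∈ Finset.range (k + 1), ‖(k.choose i : ℝ)‖ₑ * N) ?_
    (ENNReal.sum_lt_top.2 fun i _ => ENNReal.mul_lt_top (by simp) hNtop)
  rw [modulus_eq hk]
  refine iSup₂_le fun h hh => ?_
  have e : wdiff k r h F = ∑ i ∈ Finset.range (k + 1), fun x =>
      (k.choose i : ℝ) * (-1) ^ (k - i) *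
        (weight (k * h) x ^ r * F (x + (i * h - k * h / 2) * phi x)) := by
    ext x
    rw [wdiff_eq_sum, Finset.sum_apply]
  have h1 := measurable_phi
  have h2 := measurable_weight (k * h)
  rw [e]
  refine (eLpNorm_sum_le (fun i _ => Measurable.aestronglyMeasurable (by fun_prop)) hp).trans
    (Finset.sum_le_sum fun i hi => ?_)
  have hi' : i ≤ k := by simpa [Nat.lt_succ_iff] using hi
  have hα := abs_shift_coeff_le hi' hh.1
  set α : ℝ := i * h - k * h / 2
  have hm : Measurable fun x => F x * phi x ^ r := by fun_prop
  calc _ ≤ eLpNorm ((k.choose i : ℝ) • ((fun x => F x * phi x ^ r) ∘ fun x => x + α * phi x)) p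
        (volume.restrict (dom (k * h / 2))) := by
        refine eLpNorm_mono_ae ?_
        filter_upwards [ae_restrict_mem (measurableSet_dom _)] with x hx
        simp only [Pi.smul_apply, Function.comp, smul_eq_mul, norm_mul, norm_pow, norm_neg,
          norm_one, one_pow, mul_one]
        rw [mul_comm ‖F _‖]
        rw [Real.norm_of_nonneg (weight_nonneg _ _), Real.norm_of_nonneg (phi_nonneg (x + α * phi x))]
        have := weight_nonneg (k * h) x
        gcongr
        exact weight_le_phi hα hx
    _ = ‖(k.choose i : ℝ)‖ₑ * eLpNorm (fun x => F x * phi x ^ r) p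
        ((volume.restrict (dom (k * h / 2))).map fun x => x + α * phi x) := by
        rw [eLpNorm_const_smul, eLpNorm_map_measure hm.aestronglyMeasurable
          (measurable_shift α).aemeasurable]
    _ ≤ _ := by
        gcongr
        exact eLpNorm_mono_measure _ (map_shift_le hα)

/-! ### Local averages and their integral. -/

/-- The scale `√(1 - z) + t` of admissible steps at `z`, up to a factor `t`. -/
noncomputable def scale (t z : ℝ) : ℝ := √(1 - z) + t

lemma scale_pos {t : ℝ} (ht : 0 < t) (z : ℝ) : 0 < scale t z := by
  unfold scale
  positivity

lemma measurable_scale (t : ℝ) : Measurable (scale t) := by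
  unfold scale
  fun_prop

/-- The local average of the `q`-th powers of weighted backward differences at `z`. -/
noncomputable def energy (k r : ℕ) (q t : ℝ) (F : ℝ → ℝ) (z : ℝ) : ℝ≥0∞ :=
  (∫⁻ s in Set.Ioc 0 (1 / (16 * k) * t * scale t z), ‖√(1 - z) ^ r * fdiff k (-s) F z‖ₑ ^ q) /
    ENNReal.ofReal (t * scale t z)

/-- What the midpoint substitution needs: the stencil stays inside, `s = uφ(w)` has `u ≤ t`, and the
normalisation and the weight change by bounded factors only. Restricting to `z ≥ -1/2` keeps the
lowest node away from `-1`. -/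
lemma step_bounds {k : ℕ} (hk : 1 ≤ k) {t z s : ℝ} (ht : 0 < t) (ht1 : t ≤ 1)
    (hz : z ∈ Set.Icc (-1 / 2 : ℝ) 1) (hs : 0 < s) (hs2 : s ≤ 1 / (16 * k) * t * scale t z) :
    -1 ≤ z - k * s ∧ s ≤ t * phi (z - k * s / 2) ∧ phi (z - k * s / 2) ≤ 2 * scale t z ∧
      √(1 - z) ≤ 2 * √((1 - z) * (1 + (z - k * s))) := by
  have hk1 : (1 : ℝ) ≤ k := by exact_mod_cast hk
  obtain ⟨hz1, hz2⟩ := hz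
  set v := √(1 - z) with hv
  have hv0 : 0 ≤ v := Real.sqrt_nonneg _
  have hvs : v ^ 2 = 1 - z := Real.sq_sqrt (by linarith)
  have hv2 : v ≤ 2 := by nlinarith
  have hks : k * s ≤ 1 / 16 * (t * (v + t)) := by
    calc k * s ≤ k * (1 / (16 * k) * t * scale t z) := by gcongr
      _ = 1 / 16 * (t * (v + t)) := by
        rw [scale, ← hv]
        field_simp
  have hks0 : 0 < k * s := by positivity
  have hsks : s ≤ k * s := by nlinarith
  have hb : k * s ≤ 3 / 16 := by nlinarith
  have hsc : scale t z = v + t := rfl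
  have hφ : phi (z - k * s / 2) ^ 2 = (1 - z + k * s / 2) * (1 + z - k * s / 2) := by
    rw [phi_sq (abs_le.2 ⟨by linarith, by linarith⟩)]
    ring
  have hφ0 := phi_nonneg (z - k * s / 2)
  refine ⟨by linarith, ?_, ?_, ?_⟩
  · refine le_of_sq_le_sq ?_ (by positivity)
    rw [mul_pow, hφ]
    -- When `z` is near 1 the term `v²` is useless; the distance `ks/2` from the midpoint to `z`
    -- then supplies the bound.
    have h1 : s ^ 2 ≤ t ^ 2 * ((v ^ 2 + k * s / 2) * (1 / 4)) := by
      have hs1 : s ≤ 1 / 16 * (t * (v + t)) := hsks.trans hks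
      have h3 : s ^ 2 ≤ s * (1 / 16 * (t * v)) + s * (1 / 16 * t ^ 2) := by nlinarith
      have h4 : s * (1 / 16 * (t * v)) ≤ s ^ 2 / 2 + (1 / 16 * (t * v)) ^ 2 / 2 := by
        nlinarith [sq_nonneg (s - 1 / 16 * (t * v))]
      have h5 : s * t ^ 2 ≤ k * s * t ^ 2 := by gcongr
      nlinarith [mul_nonneg (sq_nonneg t) (sq_nonneg v), mul_nonneg hks0.le (sq_nonneg t)]
    refine h1.trans ?_
    rw [hvs]
    gcongr
    linarith
  · refine le_of_sq_le_sq ?_ (by rw [hsc]; positivity)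
    rw [hφ, hsc]
    have h1 : (1 - z + k * s / 2) * (1 + z - k * s / 2) ≤ (1 - z + k * s / 2) * 2 := by
      gcongr
      · linarith
    nlinarith [mul_nonneg hv0 ht.le]
  · have h2 : (2 : ℝ) = √4 := by
      rw [show (4 : ℝ) = 2 ^ 2 by norm_num, Real.sqrt_sq (by norm_num)]
    rw [hv, h2, ← Real.sqrt_mul (by norm_num)]
    apply Real.sqrt_le_sqrt
    have h3 : 0 ≤ 1 - z := by linarith
    nlinarith

lemma lintegral_eq_scaled {c : ℝ} (hc : 0 < c) {g : ℝ → ℝ≥0∞} (hg : Measurable g) :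
    ∫⁻ s, g s = ∫⁻ u, ENNReal.ofReal c * g (c * u) := by
  have hm : Measurable fun u : ℝ => c * u := by fun_prop
  rw [lintegral_const_mul (f := fun u => g (c * u)) _ (hg.comp hm), ← lintegral_map hg hm,
    Real.map_volume_mul_left hc.ne', lintegral_smul_measure, smul_eq_mul, ← mul_assoc,
    ← ENNReal.ofReal_mul hc.le, abs_of_pos (inv_pos.2 hc), mul_inv_cancel₀ hc.ne']
  simp

/-- The integrand of the energy in terms of the midpoint and the step. -/
noncomputable def midKernel (k r : ℕ) (q t : ℝ) (F : ℝ → ℝ) (v : ℝ × ℝ) : ℝ≥0∞ :=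
  {v : ℝ × ℝ | v.1 + k * v.2 / 2 ≤ 1 ∧ -1 ≤ v.1 - k * v.2 / 2 ∧ 0 < v.2 ∧
      v.2 ≤ t * phi v.1}.indicator
    (fun v => ‖√((1 - (v.1 + k * v.2 / 2)) * (1 + (v.1 - k * v.2 / 2))) ^ r *
      fdiff k v.2 F (v.1 - k * v.2 / 2)‖ₑ ^ q / ENNReal.ofReal (t * phi v.1)) v

lemma measurable_midKernel (k r : ℕ) (q t : ℝ) {F : ℝ → ℝ} (hF : Measurable F) :
    Measurable (midKernel k r q t F) := by
  have hφ := measurable_phi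
  have h3 : Measurable fun v : ℝ × ℝ => fdiff k v.2 F (v.1 - k * v.2 / 2) :=
    (measurable_fdiff k hF).comp (f := fun v : ℝ × ℝ => (v.2, v.1 - k * v.2 / 2)) (by fun_prop)
  unfold midKernel
  refine Measurable.indicator (by fun_prop) ?_
  exact (measurableSet_le (f := fun v : ℝ × ℝ => v.1 + k * v.2 / 2) (by fun_prop)
      measurable_const).inter
    ((measurableSet_le (g := fun v : ℝ × ℝ => v.1 - k * v.2 / 2) measurable_const
      (by fun_prop)).inter
    ((measurableSet_lt measurable_const measurable_snd).inter
    (measurableSet_le (g := fun v : ℝ × ℝ => t * phi v.1) measurable_snd (by fun_prop))))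

lemma energy_le_midKernel {k : ℕ} (hk : 1 ≤ k) (r : ℕ) {q t : ℝ} (hq : 1 ≤ q) (ht : 0 < t)
    (ht1 : t ≤ 1) {F : ℝ → ℝ} {z : ℝ} (hz : z ∈ Set.Icc (-1 / 2 : ℝ) 1) :
    energy k r q t F z ≤
      ∫⁻ s, 2 * (2 ^ r) ^ q * midKernel k r q t F (z - k * s / 2, s) := by
  have hsc := scale_pos ht z
  have hpos : 0 < t * scale t z := mul_pos ht hsc
  rw [energy, ENNReal.div_eq_inv_mul, ← lintegral_const_mul' _ _
    (ENNReal.inv_ne_top.2 (by simpa using hpos)), ← lintegral_indicator measurableSet_Ioc]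
  refine lintegral_mono fun s => ?_
  by_cases hs : s ∈ Set.Ioc 0 (1 / (16 * k) * t * scale t z)
  swap
  · rw [Set.indicator_of_notMem hs]
    exact zero_le
  obtain ⟨h1, h2, h3, h4⟩ := step_bounds hk ht ht1 hz hs.1 hs.2
  have e1 : z - k * s / 2 + k * s / 2 = z := by ring
  have e2 : z - k * s / 2 - k * s / 2 = z - k * s := by ring
  rw [Set.indicator_of_mem hs, midKernel, Set.indicator_of_mem]
  swap
  · exact ⟨by simpa [e1] using hz.2, by simpa [e2] using h1, hs.1, h2⟩
  simp only [e1, e2]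
  have hφ : 0 < t * phi (z - k * s / 2) := lt_of_lt_of_le hs.1 h2
  have hφ' : 0 < phi (z - k * s / 2) := pos_of_mul_pos_right hφ ht.le
  have hA : (ENNReal.ofReal (t * scale t z))⁻¹ ≤
      2 * (ENNReal.ofReal (t * phi (z - k * s / 2)))⁻¹ := by
    rw [← ENNReal.ofReal_inv_of_pos hpos, ← ENNReal.ofReal_inv_of_pos hφ,
      ← ENNReal.ofReal_ofNat 2, ← ENNReal.ofReal_mul (by norm_num)]
    apply ENNReal.ofReal_le_ofReal
    rw [← div_eq_mul_inv, inv_eq_one_div, div_le_div_iff₀ hpos hφ]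
    nlinarith
  have hB : ‖√(1 - z) ^ r * fdiff k (-s) F z‖ₑ ≤ 2 ^ r *
      ‖√((1 - z) * (1 + (z - k * s))) ^ r * fdiff k s F (z - k * s)‖ₑ := by
    have e3 : (2 : ℝ≥0∞) ^ r = ‖(2 : ℝ) ^ r‖ₑ := by
      rw [enorm_pow]
      congr 1
      rw [Real.enorm_eq_ofReal (by norm_num)]
      simp
    rw [e3, ← enorm_mul, enorm_le_iff_norm_le]
    simp only [norm_mul, norm_pow, Real.norm_eq_abs, abs_of_nonneg (Real.sqrt_nonneg _)]
    have e4 := abs_fdiff_neg k s F (z - k * s)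
    rw [sub_add_cancel] at e4
    rw [e4, ← mul_assoc, ← mul_pow, abs_of_pos (by norm_num : (0 : ℝ) < 2)]
    gcongr
  calc _ ≤ 2 * (ENNReal.ofReal (t * phi (z - k * s / 2)))⁻¹ * (2 ^ r *
      ‖√((1 - z) * (1 + (z - k * s))) ^ r * fdiff k s F (z - k * s)‖ₑ) ^ q := by gcongr
    _ = _ := by
      rw [ENNReal.mul_rpow_of_nonneg _ _ (by linarith), ENNReal.div_eq_inv_mul]
      ring

/-- Substitute `s = φ(w)u`: the Jacobian `φ(w)` cancels the one in the normalisation, and the weight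
becomes that of the modulus. -/
lemma lintegral_midKernel_le {k : ℕ} (r : ℕ) {q t : ℝ} (ht : 0 < t)
    {F : ℝ → ℝ} (hF : Measurable F) (w : ℝ) :
    ∫⁻ s, midKernel k r q t F (w, s) ≤
      ∫⁻ u in Set.Ioc 0 t, (dom (k * u / 2)).indicator
        (fun w => ‖wdiff k r u F w‖ₑ ^ q / ENNReal.ofReal t) w := by
  have hm : Measurable fun s => midKernel k r q t F (w, s) :=
    (measurable_midKernel k r q t hF).comp measurable_prodMk_left
  rcases (phi_nonneg w).eq_or_lt with h0 | h0
  · have : ∀ s, midKernel k r q t F (w, s) = 0 := by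
      intro s
      rw [midKernel, Set.indicator_of_notMem]
      rintro ⟨-, -, h1, h2⟩
      simp only [← h0, mul_zero] at h1 h2
      linarith
    simp [this]
  have hw1 : |w| < 1 := by
    rw [phi, Real.sqrt_pos] at h0
    exact (sq_lt_one_iff_abs_lt_one w).1 (by linarith)
  rw [lintegral_eq_scaled h0 hm, ← lintegral_indicator measurableSet_Ioc]
  refine lintegral_mono fun u => ?_
  by_cases hv : (w, phi w * u) ∈ {v : ℝ × ℝ | v.1 + k * v.2 / 2 ≤ 1 ∧ -1 ≤ v.1 - k * v.2 / 2 ∧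
      0 < v.2 ∧ v.2 ≤ t * phi v.1}
  swap
  · rw [midKernel, Set.indicator_of_notMem hv, mul_zero]
    exact zero_le
  rw [midKernel, Set.indicator_of_mem hv]
  obtain ⟨h1, h2, h3, h4⟩ := hv
  simp only at h1 h2 h3 h4
  have hu0 : 0 < u := pos_of_mul_pos_right h3 h0.le
  have hut : u ≤ t := by
    rw [mul_comm] at h4
    exact le_of_mul_le_mul_right h4 h0
  have hd : w ∈ dom (k * u / 2) := by
    refine ⟨hw1, ?_⟩
    rcases abs_cases w with hx | hx <;> linarith [hx.1]
  rw [Set.indicator_of_mem (show u ∈ Set.Ioc 0 t from ⟨hu0, hut⟩), Set.indicator_of_mem hd]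
  have e1 : (k : ℝ) * (phi w * u) / 2 = k * u / 2 * phi w := by ring
  have e2 : phi w * u = u * phi w := by ring
  rw [wdiff, weight_eq, e1, e2]
  rw [ENNReal.ofReal_mul ht.le, ENNReal.div_eq_inv_mul, ENNReal.div_eq_inv_mul,
    ENNReal.mul_inv (by simp [ht]) (by simp), ← mul_assoc]
  gcongr
  rw [mul_comm, mul_assoc, ENNReal.inv_mul_cancel (by simpa using h0) (by simp), mul_one]

/-- For fixed `s` the passage from `z` to the midpoint is a translation; Tonelli then leaves an
average over `u ∈ (0, t]` of quantities bounded by the `q`-th power of the modulus. -/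
lemma lintegral_energy_le {k : ℕ} (hk : 1 ≤ k) (r : ℕ) {q t : ℝ} (hq : 1 ≤ q) (ht : 0 < t)
    (ht1 : t ≤ 1) {F : ℝ → ℝ} (hF : Measurable F) :
    ∫⁻ z in Set.Icc (-1 / 2 : ℝ) 1, energy k r q t F z ≤
      2 * (2 ^ r) ^ q * modulus k r (ENNReal.ofReal q) F t ^ q := by
  have hq0 : 0 < q := by linarith
  have hφ := measurable_phi
  have hmid := measurable_midKernel k r q t hF
  have hC : (2 * (2 ^ r) ^ q : ℝ≥0∞) ≠ ⊤ :=
    ENNReal.mul_ne_top (by simp) (ENNReal.rpow_ne_top_of_nonneg hq0.le (by simp))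
  have hB : Measurable fun v : ℝ × ℝ => (dom (k * v.2 / 2)).indicator
      (fun w => ‖wdiff k r v.2 F w‖ₑ ^ q / ENNReal.ofReal t) v.1 := by
    have hf : Measurable fun v : ℝ × ℝ => wdiff k r v.2 F v.1 := by
      have h3 : Measurable fun v : ℝ × ℝ => fdiff k (v.2 * phi v.1) F
          (v.1 - k * v.2 / 2 * phi v.1) :=
        (measurable_fdiff k hF).comp
          (f := fun v : ℝ × ℝ => (v.2 * phi v.1, v.1 - k * v.2 / 2 * phi v.1)) (by fun_prop)
      unfold wdiff weight
      fun_prop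
    have hS : MeasurableSet {v : ℝ × ℝ | v.1 ∈ dom (k * v.2 / 2)} := by
      have h : Measurable fun v : ℝ × ℝ => |v.1| := by fun_prop
      exact (measurableSet_lt h measurable_const).inter
        (measurableSet_le (by fun_prop : Measurable fun v : ℝ × ℝ => k * v.2 / 2 * phi v.1)
          (measurable_const.sub h))
    have := (((hf.enorm).pow_const q).div_const (ENNReal.ofReal t)).indicator hS
    exact this
  calc ∫⁻ z in Set.Icc (-1 / 2 : ℝ) 1, energy k r q t F z
      ≤ ∫⁻ z in Set.Icc (-1 / 2 : ℝ) 1,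
          ∫⁻ s, 2 * (2 ^ r) ^ q * midKernel k r q t F (z - k * s / 2, s) :=
        setLIntegral_mono' measurableSet_Icc fun z hz => energy_le_midKernel hk r hq ht ht1 hz
    _ ≤ ∫⁻ z, ∫⁻ s, 2 * (2 ^ r) ^ q * midKernel k r q t F (z - k * s / 2, s) :=
        setLIntegral_le_lintegral _ _
    _ = ∫⁻ s, ∫⁻ z, 2 * (2 ^ r) ^ q * midKernel k r q t F (z - k * s / 2, s) := by
        refine lintegral_lintegral_swap (Measurable.aemeasurable ?_)
        exact (hmid.comp (f := fun v : ℝ × ℝ => (v.1 - k * v.2 / 2, v.2))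
          (by fun_prop)).const_mul _
    _ = ∫⁻ s, ∫⁻ w, 2 * (2 ^ r) ^ q * midKernel k r q t F (w, s) := by
        refine lintegral_congr fun s => ?_
        exact lintegral_sub_right_eq_self
          (fun w => 2 * (2 ^ r) ^ q * midKernel k r q t F (w, s)) (k * s / 2)
    _ = ∫⁻ w, ∫⁻ s, 2 * (2 ^ r) ^ q * midKernel k r q t F (w, s) := by
        refine lintegral_lintegral_swap (Measurable.aemeasurable ?_)
        exact (hmid.comp (f := fun v : ℝ × ℝ => (v.2, v.1)) (by fun_prop)).const_mul _
    _ = 2 * (2 ^ r) ^ q * ∫⁻ w, ∫⁻ s, midKernel k r q t F (w, s) := by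
        rw [← lintegral_const_mul' _ _ hC]
        exact lintegral_congr fun w => lintegral_const_mul' _ _ hC
    _ ≤ 2 * (2 ^ r) ^ q * ∫⁻ w, ∫⁻ u in Set.Ioc 0 t, (dom (k * u / 2)).indicator
        (fun w => ‖wdiff k r u F w‖ₑ ^ q / ENNReal.ofReal t) w := by
        refine mul_le_mul_right (lintegral_mono fun w => ?_) _
        exact lintegral_midKernel_le r ht hF w
    _ = 2 * (2 ^ r) ^ q * ∫⁻ u in Set.Ioc 0 t, ∫⁻ w, (dom (k * u / 2)).indicator
        (fun w => ‖wdiff k r u F w‖ₑ ^ q / ENNReal.ofReal t) w := by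
        rw [lintegral_lintegral_swap hB.aemeasurable]
    _ ≤ 2 * (2 ^ r) ^ q * ∫⁻ u in Set.Ioc 0 t,
        modulus k r (ENNReal.ofReal q) F t ^ q / ENNReal.ofReal t := by
        gcongr 2 * (2 ^ r) ^ q * ?_
        refine setLIntegral_mono' measurableSet_Ioc fun u hu => ?_
        rw [lintegral_indicator (measurableSet_dom _)]
        simp only [div_eq_mul_inv _ (ENNReal.ofReal t)]
        rw [lintegral_mul_const' _ _ (by simpa using ht)]
        gcongr
        have h1 : eLpNorm (wdiff k r u F) (ENNReal.ofReal q) (volume.restrict (dom (k * u / 2))) ≤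
            modulus k r (ENNReal.ofReal q) F t := by
          rw [modulus_eq hk]
          exact le_iSup₂_of_le u ⟨hu.1.le, hu.2⟩ le_rfl
        rw [eLpNorm_eq_lintegral_rpow_enorm_toReal (by simpa using hq0) (by simp),
          ENNReal.toReal_ofReal hq0.le] at h1
        calc _ = ((∫⁻ w in dom (k * u / 2), ‖wdiff k r u F w‖ₑ ^ q) ^ (1 / q)) ^ q := by
              rw [← ENNReal.rpow_mul, one_div_mul_cancel hq0.ne', ENNReal.rpow_one]
          _ ≤ _ := by gcongr
    _ = 2 * (2 ^ r) ^ q * modulus k r (ENNReal.ofReal q) F t ^ q := by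
        rw [setLIntegral_const, Real.volume_Ioc, sub_zero, ENNReal.div_mul_cancel]
        · simpa using ht
        · simp

/-! ### Pointwise bound of a difference by local averages. -/

lemma setLIntegral_affine_le {g : ℝ → ℝ≥0∞} (hg : Measurable g) {c d S : ℝ} (hc : 1 ≤ c)
    (hd : 0 ≤ d) : ∫⁻ s in Set.Ioc 0 S, g (d + c * s) ≤ ∫⁻ s in Set.Ioc 0 (d + c * S), g s := by
  have hc0 : 0 < c := by linarith
  set G := (Set.Ioc 0 (d + c * S)).indicator g with hG
  have hGm : Measurable G := hg.indicator measurableSet_Ioc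
  rw [← lintegral_indicator measurableSet_Ioc, ← lintegral_indicator measurableSet_Ioc, ← hG,
    ← lintegral_add_left_eq_self G d,
    lintegral_eq_scaled hc0 (g := fun x => G (d + x)) (by fun_prop)]
  refine lintegral_mono fun s => ?_
  by_cases hs : s ∈ Set.Ioc 0 S
  · rw [Set.indicator_of_mem hs]
    have hs' : d + c * s ∈ Set.Ioc 0 (d + c * S) := by
      have := mul_pos hc0 hs.1
      have := mul_le_mul_of_nonneg_left hs.2 hc0.le
      constructor <;> linarith
    simp only [hG, Set.indicator_of_mem hs']
    calc g (d + c * s) = 1 * g (d + c * s) := (one_mul _).symm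
      _ ≤ _ := by
        gcongr
        simpa using hc
  · rw [Set.indicator_of_notMem hs]
    exact zero_le

lemma measurable_energyIntegrand (k r : ℕ) (q z : ℝ) {F : ℝ → ℝ} (hF : Measurable F) :
    Measurable fun s => ‖√(1 - z) ^ r * fdiff k (-s) F z‖ₑ ^ q := by
  have h3 : Measurable fun s : ℝ => fdiff k (-s) F z :=
    (measurable_fdiff k hF).comp (f := fun s : ℝ => (-s, z)) (by fun_prop)
  fun_prop

lemma setLIntegral_energy {k r : ℕ} {q t z : ℝ} (ht : 0 < t) (F : ℝ → ℝ) :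
    ∫⁻ s in Set.Ioc 0 (1 / (16 * k) * t * scale t z), ‖√(1 - z) ^ r * fdiff k (-s) F z‖ₑ ^ q =
      energy k r q t F z * ENNReal.ofReal (t * scale t z) := by
  rw [energy, ENNReal.div_mul_cancel]
  · simpa using mul_pos ht (scale_pos ht z)
  · simp

lemma measurable_energy (k r : ℕ) (q t : ℝ) {F : ℝ → ℝ} (hF : Measurable F) :
    Measurable (energy k r q t F) := by
  have hs := measurable_scale t
  have h3 : Measurable fun v : ℝ × ℝ => fdiff k (-v.2) F v.1 :=
    (measurable_fdiff k hF).comp (f := fun v : ℝ × ℝ => (-v.2, v.1)) (by fun_prop)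
  have h4 : Measurable fun v : ℝ × ℝ =>
      {v : ℝ × ℝ | 0 < v.2 ∧ v.2 ≤ 1 / (16 * k) * t * scale t v.1}.indicator
        (fun v => ‖√(1 - v.1) ^ r * fdiff k (-v.2) F v.1‖ₑ ^ q) v := by
    refine Measurable.indicator (by fun_prop) ?_
    exact (measurableSet_lt measurable_const measurable_snd).inter
      (measurableSet_le (g := fun v : ℝ × ℝ => 1 / (16 * k) * t * scale t v.1) measurable_snd
        (by fun_prop))
  have h5 := h4.lintegral_prod_right' (ν := volume)
  unfold energy
  refine Measurable.div ?_ (by fun_prop)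
  convert h5 using 2 with z
  rw [← lintegral_indicator measurableSet_Ioc]
  rfl

/-- Every `x i` and `y i` is at most the `ℓ_q` norm of all of them. The constant appears as `M^q`,
so it stays bounded after taking `q`-th roots. -/
lemma rpow_le_of_le_sum {ι : Type*} (I : Finset ι) {q : ℝ} (hq : 1 ≤ q) (c : ι → ℝ≥0∞)
    (x y : ι → ℝ≥0∞) {a M : ℝ≥0∞} (ha : a ≤ ∑ i ∈ I, c i * (x i + y i))
    (hM : 2 * ∑ i ∈ I, c i ≤ M) : a ^ q ≤ M ^ q * ∑ i ∈ I, (x i ^ q + y i ^ q) := by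
  have hq0 : 0 < q := by linarith
  set B := (∑ i ∈ I, (x i ^ q + y i ^ q)) ^ (1 / q) with hB
  have hx : ∀ i ∈ I, x i + y i ≤ 2 * B := by
    intro i hi
    have h1 : x i ^ q + y i ^ q ≤ ∑ i ∈ I, (x i ^ q + y i ^ q) :=
      Finset.single_le_sum (f := fun i => x i ^ q + y i ^ q) (fun _ _ => zero_le) hi
    have hxB : x i ≤ B := by
      rw [hB, one_div, ENNReal.le_rpow_inv_iff hq0]
      exact le_self_add.trans h1
    have hyB : y i ≤ B := by
      rw [hB, one_div, ENNReal.le_rpow_inv_iff hq0]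
      exact le_add_self.trans h1
    rw [two_mul]
    exact add_le_add hxB hyB
  have h2 : a ≤ M * B := by
    calc a ≤ ∑ i ∈ I, c i * (2 * B) := ha.trans (Finset.sum_le_sum fun i hi => by
          gcongr
          exact hx i hi)
      _ = 2 * (∑ i ∈ I, c i) * B := by
        rw [← Finset.sum_mul]
        ring
      _ ≤ M * B := by gcongr
  calc a ^ q ≤ (M * B) ^ q := by gcongr
    _ = _ := by
      rw [ENNReal.mul_rpow_of_nonneg _ _ hq0.le, hB, ← ENNReal.rpow_mul,
        one_div_mul_cancel hq0.ne', ENNReal.rpow_one]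

lemma scale_sub_le {k l : ℕ} (hk : 1 ≤ k) (hl : l ≤ k) {t z σ : ℝ} (ht : 0 < t)
    (hz : z ≤ 1) (hσ0 : 0 ≤ σ) (hσ : σ ≤ 1 / (32 * k ^ 2) * t * scale t z) :
    scale t z ≤ scale t (z - l * σ) ∧ scale t (z - l * σ) ≤ 2 * scale t z := by
  have hk1 : (1 : ℝ) ≤ k := by exact_mod_cast hk
  have hl1 : (l : ℝ) ≤ k := by exact_mod_cast hl
  have hl0 : (0 : ℝ) ≤ l := l.cast_nonneg
  have hsc := scale_pos ht z
  have hlσ : 0 ≤ l * σ := by positivity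
  constructor
  · unfold scale
    gcongr
    linarith
  · have h1 : l * σ ≤ scale t z ^ 2 := by
      have ht' : t ≤ scale t z := by
        unfold scale
        linarith [Real.sqrt_nonneg (1 - z)]
      calc l * σ ≤ k * (1 / (32 * k ^ 2) * t * scale t z) := by gcongr
        _ = 1 / (32 * k) * (t * scale t z) := by field_simp
        _ ≤ 1 * (scale t z * scale t z) := by
          gcongr
          rw [div_le_one (by positivity)]
          linarith
        _ = _ := by ring
    have h2 : √(1 - (z - l * σ)) ≤ √(1 - z) + scale t z := by
      rw [Real.sqrt_le_left (by positivity)]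
      have h3 := Real.sq_sqrt (show 0 ≤ 1 - z by linarith)
      nlinarith [mul_nonneg (Real.sqrt_nonneg (1 - z)) hsc.le]
    rw [scale]
    have : scale t z = √(1 - z) + t := rfl
    linarith

/-- The bound `abs_fdiff_le` holds for every `s`; integrate it over `(0, S]`. The factor `64k³` is
`2k`, from at most `k` terms with scales doubled, times the `32k²` of `S`. -/
lemma rpow_fdiff_le_energy {k : ℕ} (hk : 1 ≤ k) (r : ℕ) {q t : ℝ} (hq : 1 ≤ q) (ht : 0 < t)
    {F : ℝ → ℝ} (hF : Measurable F) {z σ : ℝ} (hz : z ≤ 1)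
    (hσ0 : 0 ≤ σ) (hσ : σ ≤ 1 / (32 * k ^ 2) * t * scale t z) :
    ‖√(1 - z) ^ r * fdiff k (-σ) F z‖ₑ ^ q ≤
      64 * k ^ 3 * (2 ^ (k + 1)) ^ q * ∑ l ∈ Finset.range (k + 1), energy k r q t F (z - l * σ) := by
  have hq0 : 0 < q := by linarith
  have hk1 : (1 : ℝ) ≤ k := by exact_mod_cast hk
  have hsc := scale_pos ht z
  set S := 1 / (32 * k ^ 2) * t * scale t z with hS
  have hS0 : 0 < S := by positivity
  set E := energy k r q t F with hE
  set W := ENNReal.ofReal (t * scale t z) with hW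
  have hW0 : W ≠ 0 := by simpa [hW] using mul_pos ht hsc
  have hWt : W ≠ ⊤ := by simp [hW]
  set A := ‖√(1 - z) ^ r * fdiff k (-σ) F z‖ₑ with hA
  have hstep : ∀ s : ℝ, A ^ q ≤ (2 ^ (k + 1)) ^ q * ∑ l ∈ Finset.Icc 1 k,
      (‖√(1 - (z - l * σ)) ^ r * fdiff k (-(0 + l * s)) F (z - l * σ)‖ₑ ^ q +
        ‖√(1 - z) ^ r * fdiff k (-(σ + l * s)) F z‖ₑ ^ q) := by
    intro s
    refine rpow_le_of_le_sum _ hq (fun l => (k.choose l : ℝ≥0∞)) _ _ ?_ ?_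
    · have h := abs_fdiff_le hk (-σ) (-s) F z
      have h2 : A ≤ ENNReal.ofReal (∑ l ∈ Finset.Icc 1 k, (k.choose l : ℝ) *
          (‖√(1 - (z - l * σ)) ^ r * fdiff k (-(0 + l * s)) F (z - l * σ)‖ +
            ‖√(1 - z) ^ r * fdiff k (-(σ + l * s)) F z‖)) := by
        rw [hA, ← ofReal_norm]
        apply ENNReal.ofReal_le_ofReal
        rw [norm_mul, Real.norm_of_nonneg (r := √(1 - z) ^ r) (by positivity), Real.norm_eq_abs]
        refine (mul_le_mul_of_nonneg_left h (by positivity)).trans ?_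
        rw [Finset.mul_sum]
        refine Finset.sum_le_sum fun l hl => ?_
        have e1 : (l : ℝ) * -s = -(0 + l * s) := by ring
        have e2 : z + l * -σ = z - l * σ := by ring
        have e3 : -σ + -(0 + l * s) = -(σ + l * s) := by ring
        rw [e1, e2, e3, norm_mul, norm_mul,
          Real.norm_of_nonneg (r := √(1 - z) ^ r) (by positivity),
          Real.norm_of_nonneg (r := √(1 - (z - l * σ)) ^ r) (by positivity), Real.norm_eq_abs, Real.norm_eq_abs]
        -- Backward steps move the node away from 1, so the weight only grows.
        have h3 : √(1 - z) ^ r ≤ √(1 - (z - l * σ)) ^ r := by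
          have : 0 ≤ l * σ := by positivity
          gcongr
          linarith
        calc _ = (k.choose l : ℝ) * (√(1 - z) ^ r * |fdiff k (-(0 + l * s)) F (z - l * σ)| +
              √(1 - z) ^ r * |fdiff k (-(σ + l * s)) F z|) := by ring
          _ ≤ _ := by gcongr
      refine h2.trans (le_of_eq ?_)
      rw [ENNReal.ofReal_sum_of_nonneg fun l _ => by positivity]
      refine Finset.sum_congr rfl fun l _ => ?_
      rw [ENNReal.ofReal_mul (by positivity), ENNReal.ofReal_add (by positivity) (by positivity),
        ofReal_norm, ofReal_norm, ENNReal.ofReal_natCast]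
    · rw [pow_succ', ← Nat.cast_sum]
      gcongr
      have h1 : ∑ l ∈ Finset.Icc 1 k, k.choose l ≤ 2 ^ k := by
        rw [← Nat.sum_range_choose]
        refine Finset.sum_le_sum_of_subset fun i hi => ?_
        simp at hi ⊢
        omega
      exact_mod_cast h1
  have hint : A ^ q * ENNReal.ofReal S ≤ (2 ^ (k + 1)) ^ q * ∑ l ∈ Finset.Icc 1 k,
      (E (z - l * σ) * (2 * W) + E z * (2 * W)) := by
    have h1 : A ^ q * ENNReal.ofReal S = ∫⁻ _ in Set.Ioc 0 S, A ^ q := by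
      rw [setLIntegral_const, Real.volume_Ioc, sub_zero]
    rw [h1]
    refine (lintegral_mono fun s => hstep s).trans ?_
    have hm1 : ∀ (w d c : ℝ), Measurable fun s =>
        ‖√(1 - w) ^ r * fdiff k (-(d + c * s)) F w‖ₑ ^ q := fun w d c =>
      (measurable_energyIntegrand k r q w hF).comp (f := fun s => d + c * s) (by fun_prop)
    have hm2 : ∀ l ∈ Finset.Icc 1 k, Measurable fun s : ℝ =>
        ‖√(1 - (z - l * σ)) ^ r * fdiff k (-(0 + l * s)) F (z - l * σ)‖ₑ ^ q +
          ‖√(1 - z) ^ r * fdiff k (-(σ + l * s)) F z‖ₑ ^ q := fun l _ =>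
      (hm1 _ _ _).add (hm1 _ _ _)
    rw [lintegral_const_mul' _ _ (ENNReal.rpow_ne_top_of_nonneg hq0.le (by simp)),
      lintegral_finsetSum _ hm2]
    gcongr with l hl
    rw [lintegral_add_left (hm1 _ _ _)]
    obtain ⟨hl1, hlk⟩ := Finset.mem_Icc.1 hl
    have hl1' : (1 : ℝ) ≤ l := by exact_mod_cast hl1
    have hlk' : (l : ℝ) ≤ k := by exact_mod_cast hlk
    obtain ⟨hs1, hs2⟩ := scale_sub_le hk hlk ht hz hσ0 hσ
    -- This fixes the ratio of `32k²` to `16k`: both `ls` and `σ + ls` must stay within the range of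
    -- integration in `energy`.
    have hlS : (l + 1) * S ≤ 1 / (16 * k) * t * scale t z := by
      calc (l + 1) * S ≤ (2 * k) * S := by gcongr; linarith
        _ = _ := by
          rw [hS]
          field_simp
          norm_num
    refine add_le_add ?_ ?_
    · refine (setLIntegral_affine_le (measurable_energyIntegrand k r q (z - l * σ) hF) hl1'
        le_rfl).trans ?_
      refine (lintegral_mono_set (Set.Ioc_subset_Ioc_right (a₁ :=
        1 / (16 * k) * t * scale t (z - l * σ)) ?_)).trans ?_
      · calc 0 + l * S ≤ (l + 1) * S := by linarith
          _ ≤ 1 / (16 * k) * t * scale t z := hlS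
          _ ≤ _ := by gcongr
      · rw [setLIntegral_energy ht]
        gcongr
        rw [hW, ← ENNReal.ofReal_ofNat 2, ← ENNReal.ofReal_mul (by norm_num)]
        apply ENNReal.ofReal_le_ofReal
        nlinarith
    · refine (setLIntegral_affine_le (measurable_energyIntegrand k r q z hF) hl1'
        hσ0).trans ?_
      refine (lintegral_mono_set (Set.Ioc_subset_Ioc_right (a₁ :=
        1 / (16 * k) * t * scale t z) ?_)).trans ?_
      · calc σ + l * S ≤ (l + 1) * S := by linarith
          _ ≤ 1 / (16 * k) * t * scale t z := hlS
      · rw [setLIntegral_energy ht]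
        gcongr
        rw [two_mul]
        exact le_self_add
  set T := ∑ l ∈ Finset.range (k + 1), E (z - l * σ) with hT
  have hsum : ∑ l ∈ Finset.Icc 1 k, (E (z - l * σ) * (2 * W) + E z * (2 * W)) ≤
      2 * k * T * W := by
    have h1 : ∀ l ∈ Finset.Icc 1 k, E (z - l * σ) + E z ≤ T := by
      intro l hl
      obtain ⟨hl1, hlk⟩ := Finset.mem_Icc.1 hl
      have hsub : ({l, 0} : Finset ℕ) ⊆ Finset.range (k + 1) := by
        intro i hi
        simp at hi ⊢
        omega
      have := Finset.sum_le_sum_of_subset (f := fun l : ℕ => E (z - l * σ)) hsub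
      rw [Finset.sum_pair (by omega)] at this
      simpa using this
    calc _ = ∑ l ∈ Finset.Icc 1 k, (E (z - l * σ) + E z) * (2 * W) := by simp only [add_mul]
      _ ≤ ∑ l ∈ Finset.Icc 1 k, T * (2 * W) := by
        gcongr with l hl
        exact h1 l hl
      _ = _ := by
        rw [Finset.sum_const, Nat.card_Icc, nsmul_eq_mul]
        simp
        ring
  have hSW : ENNReal.ofReal S = ENNReal.ofReal (1 / (32 * k ^ 2)) * W := by
    rw [hS, mul_assoc, ENNReal.ofReal_mul (by positivity)]
  have hfin : A ^ q * ENNReal.ofReal (1 / (32 * k ^ 2)) * W ≤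
      (2 ^ (k + 1)) ^ q * (2 * k * T) * W := by
    rw [mul_assoc, ← hSW]
    refine hint.trans ?_
    rw [mul_assoc ((2 ^ (k + 1)) ^ q : ℝ≥0∞)]
    gcongr
  rw [ENNReal.mul_le_mul_iff_left hW0 hWt] at hfin
  have hk2 : ENNReal.ofReal (1 / (32 * k ^ 2)) * (32 * k ^ 2) = 1 := by
    have : (32 * k ^ 2 : ℝ≥0∞) = ENNReal.ofReal (32 * k ^ 2) := by
      rw [ENNReal.ofReal_mul (by norm_num), ENNReal.ofReal_pow (by positivity)]
      simp
    rw [this, ← ENNReal.ofReal_mul (by positivity)]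
    rw [one_div_mul_cancel (by positivity), ENNReal.ofReal_one]
  calc A ^ q = A ^ q * ENNReal.ofReal (1 / (32 * k ^ 2)) * (32 * k ^ 2) := by
        rw [mul_assoc, hk2, mul_one]
    _ ≤ (2 ^ (k + 1)) ^ q * (2 * k * T) * (32 * k ^ 2) := by gcongr
    _ = _ := by ring

/-! ### Reflection, and blocks with admissible step. -/

lemma phi_neg (x : ℝ) : phi (-x) = phi x := by simp [phi]

lemma weight_neg (δ x : ℝ) : weight δ (-x) = weight δ x := by
  rw [weight, weight, phi_neg]
  congr 1
  ring

lemma abs_wdiff_reflect (k r : ℕ) (h : ℝ) (F : ℝ → ℝ) (x : ℝ) :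
    |wdiff k r h (fun x => F (-x)) (-x)| = |wdiff k r h F x| := by
  rw [wdiff, wdiff, weight_neg, phi_neg, fdiff_reflect, abs_mul, abs_mul,
    ← abs_fdiff_neg k (h * phi x) F]
  congr 3
  ring

lemma measurePreserving_neg_dom (a : ℝ) :
    MeasurePreserving (fun x : ℝ => -x) (volume.restrict (dom a)) (volume.restrict (dom a)) := by
  have h := (Measure.measurePreserving_neg (volume : Measure ℝ)).restrict_preimage
    (measurableSet_dom a)
  have e : Neg.neg ⁻¹' (dom a) = dom a := by
    ext x
    simp [dom, phi_neg]
  rw [e] at h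
  exact h

lemma modulus_reflect {k : ℕ} (hk : 1 ≤ k) (r : ℕ) (p : ℝ≥0∞) {F : ℝ → ℝ} (hF : Measurable F)
    (t : ℝ) : modulus k r p (fun x => F (-x)) t = modulus k r p F t := by
  rw [modulus_eq hk, modulus_eq hk]
  refine iSup_congr fun h => iSup_congr fun _ => ?_
  have hm : Measurable (wdiff k r h fun x => F (-x)) := measurable_wdiff k r h (by fun_prop)
  rw [← eLpNorm_comp_measurePreserving hm.aestronglyMeasurable
    (measurePreserving_neg_dom (k * h / 2))]
  exact eLpNorm_congr_norm_ae (Filter.Eventually.of_forall fun x =>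
    abs_wdiff_reflect k r h F x)

/-- The weighted `k`-th difference with step `τ φ(x)` and lowest node `x + α φ(x)`. -/
noncomputable def block (k r : ℕ) (H α τ : ℝ) (F : ℝ → ℝ) (x : ℝ) : ℝ :=
  weight (k * H) x ^ r * fdiff k (τ * phi x) F (x + α * phi x)

lemma measurable_block (k r : ℕ) (H α τ : ℝ) {F : ℝ → ℝ} (hF : Measurable F) :
    Measurable (block k r H α τ F) := by
  have h1 := measurable_phi
  have h2 := measurable_weight (k * H)
  have h3 : Measurable fun x => fdiff k (τ * phi x) F (x + α * phi x) :=
    (measurable_fdiff k hF).comp (f := fun x => (τ * phi x, x + α * phi x)) (by fun_prop)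
  unfold block
  fun_prop

/-- Reflection exchanges highest and lowest node, hence the new offset `-(α + kτ)`. -/
lemma block_reflect (k r : ℕ) (H α τ : ℝ) (F : ℝ → ℝ) (x : ℝ) :
    |block k r H (-(α + k * τ)) τ (fun x => F (-x)) (-x)| = |block k r H α τ F x| := by
  rw [block, block, weight_neg, phi_neg, fdiff_reflect, abs_mul, abs_mul,
    ← abs_fdiff_neg k (τ * phi x) F]
  congr 3
  ring

lemma weight_le_sqrt {k : ℕ} {H α x : ℝ} (h0 : 0 ≤ k * H / 2)
    (hα : α ≤ k * H / 2) (hx : x ∈ dom (k * H / 2)) :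
    weight (k * H) x ≤ 2 * √(1 - (x + α * phi x)) := by
  have h2 : 2 * √(1 - (x + α * phi x)) = √(4 * (1 - (x + α * phi x))) := by
    rw [Real.sqrt_mul (by norm_num), show (4 : ℝ) = 2 ^ 2 by norm_num,
      Real.sqrt_sq (by norm_num)]
  rw [weight_eq, h2]
  apply Real.sqrt_le_sqrt
  have h1 := hx.2
  have h3 := phi_nonneg x
  have h4 := neg_abs_le x
  have h5 := le_abs_self x
  have h6 : 0 ≤ 1 - (x + k * H / 2 * phi x) := by linarith
  have h7 : 0 ≤ 1 + (x - k * H / 2 * phi x) := by linarith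
  have h8 : 1 - (x + k * H / 2 * phi x) ≤ 1 - (x + α * phi x) := by nlinarith
  have h9 : 0 ≤ k * H / 2 * phi x := mul_nonneg h0 h3
  have h10 := hx.1
  calc _ ≤ (1 - (x + k * H / 2 * phi x)) * 2 := by
        gcongr
        linarith
    _ ≤ _ := by linarith

/-- The step `τ φ(x)` is admissible at the node `x + γ φ(x)`, seen from the right end point. -/
def StepOK (k : ℕ) (t τ γ x : ℝ) : Prop :=
  τ * phi x ≤ 1 / (32 * k ^ 2) * t * scale t (x + γ * phi x)

/-- Pointwise bound of a block whose highest node is nonnegative. -/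
lemma rpow_block_le_of_nonneg {k : ℕ} (hk : 1 ≤ k) (r : ℕ) {q t : ℝ} (hq : 1 ≤ q) (ht : 0 < t)
    (ht1 : t ≤ 1) {F : ℝ → ℝ} (hF : Measurable F) {H α τ x : ℝ}
    (hγ : |α + k * τ| ≤ k * H / 2) (hτ : 0 ≤ τ) (hx : x ∈ dom (k * H / 2))
    (hz : 0 ≤ x + (α + k * τ) * phi x) (hok : StepOK k t τ (α + k * τ) x) :
    ‖block k r H α τ F x‖ₑ ^ q ≤ (2 ^ r) ^ q * (64 * k ^ 3 * (2 ^ (k + 1)) ^ q) *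
      ∑ l ∈ Finset.range (k + 1),
        (Set.Icc (-1 / 2 : ℝ) 1).indicator (energy k r q t F) (x + (α + k * τ - l * τ) * phi x) := by
  have hk1 : (1 : ℝ) ≤ k := by exact_mod_cast hk
  have hq0 : 0 < q := by linarith
  set z := x + (α + k * τ) * phi x with hzdef
  have hz1 : z ≤ 1 := (shift_mem hγ hx).2
  have hσ0 : 0 ≤ τ * phi x := mul_nonneg hτ (phi_nonneg x)
  -- With highest node at least 0, this puts all nodes in `[-1/2, 1]`, where the integral of
  -- `energy` is controlled.
  have hσk : k * (τ * phi x) ≤ 1 / 2 := by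
    have h1 : scale t z ≤ 2 := by
      have : √(1 - z) ≤ 1 := Real.sqrt_le_one.2 (by linarith)
      unfold scale
      linarith
    calc k * (τ * phi x) ≤ k * (1 / (32 * k ^ 2) * t * scale t z) :=
          mul_le_mul_of_nonneg_left hok (by positivity)
      _ = 1 / (32 * k) * (t * scale t z) := by field_simp
      _ ≤ 1 / 4 * (1 * 2) := by
        have := scale_pos ht z
        gcongr
        linarith
      _ = _ := by norm_num
  have e1 : ∀ l ∈ Finset.range (k + 1), energy k r q t F (z - l * (τ * phi x)) =
      (Set.Icc (-1 / 2 : ℝ) 1).indicator (energy k r q t F)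
        (x + (α + k * τ - l * τ) * phi x) := by
    intro l hl
    have hlk : (l : ℝ) ≤ k := by
      have : l ≤ k := by simpa [Nat.lt_succ_iff] using hl
      exact_mod_cast this
    have hl0 : (0 : ℝ) ≤ l := l.cast_nonneg
    have e2 : x + (α + k * τ - l * τ) * phi x = z - l * (τ * phi x) := by
      rw [hzdef]
      ring
    rw [e2, Set.indicator_of_mem]
    have h1 : l * (τ * phi x) ≤ k * (τ * phi x) := by gcongr
    have h2 : 0 ≤ l * (τ * phi x) := by positivity
    constructor <;> linarith
  rw [← Finset.sum_congr rfl e1, mul_assoc ((2 ^ r) ^ q : ℝ≥0∞)]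
  refine le_trans ?_ (mul_le_mul_right (rpow_fdiff_le_energy hk r hq ht hF hz1 hσ0 hok) _)
  rw [← ENNReal.mul_rpow_of_nonneg _ _ hq0.le]
  gcongr
  have e3 : (2 : ℝ≥0∞) ^ r = ‖(2 : ℝ) ^ r‖ₑ := by
    rw [enorm_pow]
    congr 1
    rw [Real.enorm_eq_ofReal (by norm_num)]
    simp
  rw [e3, ← enorm_mul, enorm_le_iff_norm_le, block]
  have e4 := abs_fdiff_neg k (τ * phi x) F (x + α * phi x)
  have e5 : x + α * phi x + k * (τ * phi x) = z := by
    rw [hzdef]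
    ring
  rw [e5] at e4
  simp only [norm_mul, norm_pow, Real.norm_eq_abs, abs_of_nonneg (Real.sqrt_nonneg _),
    abs_of_nonneg (weight_nonneg _ _)]
  rw [e4, ← mul_assoc, ← mul_pow, abs_of_pos (by norm_num : (0 : ℝ) < 2)]
  have := weight_nonneg (k * H) x
  gcongr
  exact weight_le_sqrt ((abs_nonneg _).trans hγ) (abs_le.1 hγ).2 hx

lemma lintegral_indicator_energy_le {k : ℕ} (hk : 1 ≤ k) (r : ℕ) {q t : ℝ} (hq : 1 ≤ q)
    (ht : 0 < t) (ht1 : t ≤ 1) {F : ℝ → ℝ} (hF : Measurable F) {a γ : ℝ} (hγ : |γ| ≤ a) :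
    ∫⁻ x in dom a, (Set.Icc (-1 / 2 : ℝ) 1).indicator (energy k r q t F) (x + γ * phi x) ≤
      2 * (2 * (2 ^ r) ^ q * modulus k r (ENNReal.ofReal q) F t ^ q) := by
  refine (lintegral_shift_le hγ
    ((measurable_energy k r q t hF).indicator measurableSet_Icc)).trans ?_
  gcongr
  refine (setLIntegral_le_lintegral _ _).trans ?_
  rw [lintegral_indicator measurableSet_Icc]
  exact lintegral_energy_le hk r hq ht ht1 hF

/-- If the highest node is negative, the reflected block has a nonnegative one. Adding both
majorants avoids splitting the domain; this is why admissibility is assumed at both outer nodes. -/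
lemma lintegral_block_le {k : ℕ} (hk : 1 ≤ k) (r : ℕ) {q t : ℝ} (hq : 1 ≤ q) (ht : 0 < t)
    (ht1 : t ≤ 1) {F : ℝ → ℝ} (hF : Measurable F) {H α τ : ℝ} (hτ : 0 ≤ τ)
    (hα : |α| ≤ k * H / 2) (hγ : |α + k * τ| ≤ k * H / 2)
    (hok : ∀ x ∈ dom (k * H / 2), StepOK k t τ (α + k * τ) x)
    (hok' : ∀ x ∈ dom (k * H / 2), StepOK k t τ (-α) x) :
    ∫⁻ x in dom (k * H / 2), ‖block k r H α τ F x‖ₑ ^ q ≤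
      512 * k ^ 3 * (k + 1) * (2 ^ (2 * r + k + 1) * modulus k r (ENNReal.ofReal q) F t) ^ q := by
  have hq0 : 0 < q := by linarith
  set G : ℝ → ℝ := fun x => F (-x) with hG
  have hGm : Measurable G := by fun_prop
  set I : (ℝ → ℝ) → ℝ → ℝ≥0∞ := fun F =>
    (Set.Icc (-1 / 2 : ℝ) 1).indicator (energy k r q t F) with hI
  set C : ℝ≥0∞ := (2 ^ r) ^ q * (64 * k ^ 3 * (2 ^ (k + 1)) ^ q) with hC
  have hIm : ∀ (F : ℝ → ℝ), Measurable F → ∀ γ : ℝ, Measurable fun x => I F (x + γ * phi x) :=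
    fun F hF γ => ((measurable_energy k r q t hF).indicator measurableSet_Icc).comp
      (measurable_shift γ)
  have hint : ∀ (F : ℝ → ℝ), Measurable F → ∀ α : ℝ, |α| ≤ k * H / 2 → |α + k * τ| ≤ k * H / 2 →
      ∫⁻ x in dom (k * H / 2), C * ∑ l ∈ Finset.range (k + 1),
        I F (x + (α + k * τ - l * τ) * phi x) ≤
      C * ((k + 1) * (2 * (2 * (2 ^ r) ^ q * modulus k r (ENNReal.ofReal q) F t ^ q))) := by
    intro F hF α hα hγ
    rw [lintegral_const_mul _ (Finset.measurable_sum _ fun l _ => hIm F hF _),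
      lintegral_finsetSum _ fun l _ => hIm F hF _]
    gcongr C * ?_
    refine (Finset.sum_le_sum (g := fun _ => 2 * (2 * (2 ^ r) ^ q *
      modulus k r (ENNReal.ofReal q) F t ^ q)) fun l hl => ?_).trans ?_
    · refine lintegral_indicator_energy_le hk r hq ht ht1 hF ?_
      have hlk : (l : ℝ) ≤ k := by
        have : l ≤ k := by simpa [Nat.lt_succ_iff] using hl
        exact_mod_cast this
      have hl0 : (0 : ℝ) ≤ l := l.cast_nonneg
      rw [abs_le] at hα hγ ⊢
      constructor <;> nlinarith
    · rw [Finset.sum_const, nsmul_eq_mul, Finset.card_range]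
      push_cast
      rfl
  set J : (ℝ → ℝ) → ℝ → ℝ → ℝ≥0∞ := fun F α x => C * ∑ l ∈ Finset.range (k + 1),
        I F (x + (α + k * τ - l * τ) * phi x) with hJ
  have hJm : ∀ (F : ℝ → ℝ), Measurable F → ∀ α : ℝ, Measurable (J F α) := fun F hF α =>
    (Finset.measurable_sum _ fun l _ => hIm F hF _).const_mul _
  have hpt : ∀ x ∈ dom (k * H / 2), ‖block k r H α τ F x‖ₑ ^ q ≤
      J F α x + J G (-(α + k * τ)) (-x) := by
    intro x hx
    rcases le_total 0 (x + (α + k * τ) * phi x) with hz | hz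
    · exact (rpow_block_le_of_nonneg hk r hq ht ht1 hF hγ hτ hx hz (hok x hx)).trans le_self_add
    · have hx' : -x ∈ dom (k * H / 2) := by simpa [dom, phi_neg] using hx
      have e1 : -(α + k * τ) + k * τ = -α := by ring
      have h := rpow_block_le_of_nonneg hk r hq ht ht1 hGm (α := -(α + k * τ)) (H := H)
        (by rw [e1, abs_neg]; exact hα) hτ hx'
        (by
          rw [e1, phi_neg]
          have h1 : 0 ≤ k * τ * phi x := by have := phi_nonneg x; positivity
          nlinarith)
        (by rw [e1]; exact hok' _ hx')
      refine le_trans (le_of_eq ?_) (h.trans le_add_self)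
      congr 1
      rw [← ofReal_norm, ← ofReal_norm, Real.norm_eq_abs, Real.norm_eq_abs, block_reflect]
  calc _ ≤ ∫⁻ x in dom (k * H / 2), (J F α x + J G (-(α + k * τ)) (-x)) :=
        setLIntegral_mono' (measurableSet_dom _) hpt
    _ = (∫⁻ x in dom (k * H / 2), J F α x) +
        ∫⁻ x in dom (k * H / 2), J G (-(α + k * τ)) x := by
        rw [lintegral_add_left (hJm F hF α)]
        congr 1
        exact (measurePreserving_neg_dom (k * H / 2)).lintegral_comp (hJm G hGm _)
    _ ≤ C * ((k + 1) * (2 * (2 * (2 ^ r) ^ q * modulus k r (ENNReal.ofReal q) F t ^ q))) +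
        C * ((k + 1) * (2 * (2 * (2 ^ r) ^ q * modulus k r (ENNReal.ofReal q) F t ^ q))) := by
        refine add_le_add (hint F hF α hα hγ) ?_
        rw [← modulus_reflect hk r _ hF]
        exact hint G hGm _ (by rwa [abs_neg]) (by
          rw [show -(α + k * τ) + k * τ = -α by ring, abs_neg]; exact hα)
    _ = _ := by
        have h2 : ((2 : ℝ≥0∞) ^ (2 * r + k + 1)) ^ q =
            (2 ^ r) ^ q * (2 ^ (k + 1)) ^ q * (2 ^ r) ^ q := by
          rw [← ENNReal.mul_rpow_of_nonneg _ _ hq0.le, ← ENNReal.mul_rpow_of_nonneg _ _ hq0.le]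
          congr 1
          ring
        rw [hC, ENNReal.mul_rpow_of_nonneg _ _ hq0.le, h2]
        ring

/-- The constant in the bound of a block with an admissible step. -/
noncomputable def blockConst (k r : ℕ) : ℝ≥0∞ := 512 * k ^ 3 * (k + 1) * 2 ^ (2 * r + k + 1)

lemma eLpNorm_block_le {k : ℕ} (hk : 1 ≤ k) (r : ℕ) {q t : ℝ} (hq : 1 ≤ q) (ht : 0 < t)
    (ht1 : t ≤ 1) {F : ℝ → ℝ} (hF : Measurable F) {H α τ : ℝ} (hτ : 0 ≤ τ)
    (hα : |α| ≤ k * H / 2) (hγ : |α + k * τ| ≤ k * H / 2)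
    (hok : ∀ x ∈ dom (k * H / 2), StepOK k t τ (α + k * τ) x)
    (hok' : ∀ x ∈ dom (k * H / 2), StepOK k t τ (-α) x) :
    eLpNorm (block k r H α τ F) (ENNReal.ofReal q) (volume.restrict (dom (k * H / 2))) ≤
      blockConst k r * modulus k r (ENNReal.ofReal q) F t := by
  have hq0 : 0 < q := by linarith
  rw [eLpNorm_eq_lintegral_rpow_enorm_toReal (by simpa using hq0) (by simp),
    ENNReal.toReal_ofReal hq0.le, one_div, ENNReal.rpow_inv_le_iff hq0]
  refine (lintegral_block_le hk r hq ht ht1 hF hτ hα hγ hok hok').trans ?_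
  rw [blockConst, mul_assoc (512 * k ^ 3 * (k + 1) : ℝ≥0∞),
    ENNReal.mul_rpow_of_nonneg (512 * k ^ 3 * (k + 1) : ℝ≥0∞) _ hq0.le]
  gcongr
  -- The numerical factor is at least 1, so its `q`-th root is at most itself; thus the constant is
  -- free of `q`.
  refine ENNReal.le_rpow_self_of_one_le ?_ hq
  have : (1 : ℝ≥0∞) ≤ k := by exact_mod_cast hk
  calc (1 : ℝ≥0∞) = 1 * 1 ^ 3 * 1 := by norm_num
    _ ≤ 512 * k ^ 3 * (k + 1) := by
      gcongr
      · norm_num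
      · exact le_add_self

/-! ### Cutting a large difference into admissible blocks. -/

/-- The scale decreases towards 1, so checking the outermost node of a block suffices for all its
sub-blocks. -/
lemma StepOK.mono {k : ℕ} {t τ γ γ' x : ℝ} (ht : 0 < t) (h : StepOK k t τ γ' x) (hγ : γ ≤ γ') :
    StepOK k t τ γ x := by
  have := phi_nonneg x
  unfold StepOK scale at *
  refine h.trans ?_
  gcongr

lemma block_subdivide (k r : ℕ) (H α τ : ℝ) (F : ℝ → ℝ) {m : ℕ} (hm : 1 ≤ m) :
    block k r H α τ F = ∑ j : Fin k → Fin m,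
      block k r H (α + ((∑ i, (j i : ℕ) : ℕ) : ℝ) * (τ / m)) (τ / m) F := by
  ext x
  have hm0 : (m : ℝ) ≠ 0 := by positivity
  rw [Finset.sum_apply, block]
  have e : τ * phi x = m * (τ / m * phi x) := by field_simp
  rw [e, fdiff_subdivide, Finset.mul_sum]
  refine Finset.sum_congr rfl fun j _ => ?_
  rw [block]
  congr 2
  ring

lemma sum_fin_le {k m : ℕ} (j : Fin k → Fin m) :
    (((∑ i, (j i : ℕ) : ℕ) : ℝ)) + k ≤ k * m := by
  have : ∑ i, ((j i : ℕ) + 1) ≤ ∑ _i : Fin k, m :=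
    Finset.sum_le_sum fun i _ => (j i).2
  rw [Finset.sum_add_distrib] at this
  simp only [Finset.sum_const, Finset.card_univ, Fintype.card_fin, smul_eq_mul, mul_one] at this
  exact_mod_cast this

lemma eLpNorm_subdivided_block_le {k : ℕ} (hk : 1 ≤ k) (r : ℕ) {q t : ℝ} (hq : 1 ≤ q)
    (ht : 0 < t) (ht1 : t ≤ 1) {F : ℝ → ℝ} (hF : Measurable F) {H α τ : ℝ} (hτ : 0 ≤ τ)
    (hα : |α| ≤ k * H / 2) (hγ : |α + k * τ| ≤ k * H / 2) {m : ℕ} (hm : 1 ≤ m)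
    (hok : ∀ x ∈ dom (k * H / 2), StepOK k t (τ / m) (α + k * τ) x)
    (hok' : ∀ x ∈ dom (k * H / 2), StepOK k t (τ / m) (-α) x) :
    eLpNorm (block k r H α τ F) (ENNReal.ofReal q) (volume.restrict (dom (k * H / 2))) ≤
      (m : ℝ≥0∞) ^ k * (blockConst k r * modulus k r (ENNReal.ofReal q) F t) := by
  have hm0 : (0 : ℝ) < m := by exact_mod_cast hm
  rw [block_subdivide k r H α τ F hm]
  refine (eLpNorm_sum_le (fun j _ => (measurable_block k r H _ _ hF).aestronglyMeasurable)
    (by simpa using hq)).trans ?_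
  refine (Finset.sum_le_sum (g := fun _ => blockConst k r *
    modulus k r (ENNReal.ofReal q) F t) fun j _ => ?_).trans ?_
  · have hj := sum_fin_le j
    have hj0 : (0 : ℝ) ≤ ((∑ i, (j i : ℕ) : ℕ) : ℝ) := Nat.cast_nonneg _
    generalize ((∑ i, (j i : ℕ) : ℕ) : ℝ) = s at *
    have hτm : 0 ≤ τ / m := by positivity
    have e : k * τ = k * m * (τ / m) := by field_simp
    have h1 : α + s * (τ / m) + k * (τ / m) ≤ α + k * τ := by
      rw [e]
      nlinarith
    have h2 : 0 ≤ s * (τ / m) := by positivity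
    have h3 : 0 ≤ k * (τ / m) := by positivity
    rw [abs_le] at hα hγ
    refine eLpNorm_block_le hk r hq ht ht1 hF hτm (abs_le.2 ⟨by linarith, by linarith⟩)
      (abs_le.2 ⟨by linarith, by linarith⟩) (fun x hx => (hok x hx).mono ht h1)
      (fun x hx => (hok' x hx).mono ht (by linarith))
  · rw [Finset.sum_const, nsmul_eq_mul, Finset.card_univ]
    simp

/-- A node `q` small steps inside the stencil satisfies `1 - z ≥ θφ(x)²/4` with `θ = 2q/(kn)`, since
the extreme node is still at most 1. So `√(1 - z)` is at least of order `φ(x)√(q/(kn))`, and cutting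
by `√(kn/q)` suffices. -/
lemma stepOK_of_cutSize_le {k : ℕ} (hk : 1 ≤ k) {t H : ℝ} (ht : 0 < t) (hH : 0 ≤ H) {n q m : ℕ}
    (hn : 1 ≤ n) (hm : 1 ≤ m) (hHn : H / n ≤ t / (64 * k ^ 2)) (hq : q ≤ k * n)
    (hcut : cutSize k n q ≤ m) {x : ℝ} (hx : x ∈ dom (k * H / 2)) :
    StepOK k t (H / n / m) (k * H / 2 - q * (H / n)) x := by
  have hk1 : (1 : ℝ) ≤ k := by exact_mod_cast hk
  have hn1 : (1 : ℝ) ≤ n := by exact_mod_cast hn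
  have hm1 : (1 : ℝ) ≤ m := by exact_mod_cast hm
  set a : ℝ := k * H / 2 with ha
  have ha0 : 0 ≤ a := by positivity
  have hφ0 := phi_nonneg x
  have hd := hx.2
  have h4 := neg_abs_le x
  have h5 := le_abs_self x
  have hφ2 : phi x ^ 2 ≤ 2 * (1 - x) := by
    rw [phi_sq hx.1.le]
    nlinarith [hx.1]
  have haφ : a * phi x ≤ 1 - x := by linarith
  have hN0 : 0 ≤ H / n := by positivity
  have key : ∀ v : ℝ, phi x / m ≤ 2 * v → H / n / m * phi x ≤ 1 / (32 * k ^ 2) * t * v := by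
    intro v hv
    have hv0 : 0 ≤ phi x / m := by positivity
    calc H / n / m * phi x = H / n * (phi x / m) := by ring
      _ ≤ t / (64 * k ^ 2) * (2 * v) := by gcongr
      _ = _ := by
        field_simp
        ring
  unfold StepOK
  have hvle : ∀ z, √(1 - z) ≤ scale t z := fun z => by
    unfold scale
    linarith
  rcases Nat.eq_zero_or_pos q with rfl | hq0
  · rw [cutSize, if_pos rfl] at hcut
    simp only [Nat.cast_zero, zero_mul, sub_zero]
    -- At `q = 0` the node may be 1 itself. If `φ(x) ≤ 4a`, cutting by `n` makes the step
    -- `O((H/n)²)`, which the summand `t` of the scale absorbs; otherwise `aφ(x) ≤ φ(x)²/4` leaves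
    -- room before 1.
    rcases le_total (phi x) (4 * a) with h | h
    · have h6 : t ≤ scale t (x + a * phi x) := by
        unfold scale
        linarith [Real.sqrt_nonneg (1 - (x + a * phi x))]
      have h7 : H / n / m * phi x ≤ (H / n) ^ 2 * (2 * k) := by
        calc H / n / m * phi x ≤ H / n / n * (4 * a) := by gcongr
          _ = _ := by
            rw [ha]
            field_simp
            norm_num
      have h8 : (H / n) ^ 2 * (2 * k) ≤ (t / (64 * k ^ 2)) ^ 2 * (2 * k) := by gcongr
      have h9 : (t / (64 * k ^ 2)) ^ 2 * (2 * k) = 1 / (32 * k ^ 2) * t * t * (1 / (64 * k)) := by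
        field_simp
        norm_num
      have h10 : 1 / (64 * (k : ℝ)) ≤ 1 := by
        rw [div_le_one (by positivity)]
        linarith
      calc _ ≤ 1 / (32 * k ^ 2) * t * t * (1 / (64 * k)) := (h7.trans h8).trans h9.le
        _ ≤ 1 / (32 * k ^ 2) * t * t * 1 := by gcongr
        _ ≤ _ := by
          rw [mul_one]
          gcongr
    · refine key _ ?_
      have h6 : phi x / m ≤ phi x := div_le_self hφ0 hm1
      have h7 : phi x / 2 ≤ √(1 - (x + a * phi x)) := by
        apply Real.le_sqrt_of_sq_le
        nlinarith
      linarith [hvle (x + a * phi x)]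
  · have hq1 : (1 : ℝ) ≤ q := by exact_mod_cast hq0
    rw [cutSize, if_neg hq0.ne'] at hcut
    have hqk : (q : ℝ) ≤ k * n := by exact_mod_cast hq
    refine key _ ?_
    set θ : ℝ := 2 * q / (k * n) with hθ
    have hθ0 : 0 < θ := by positivity
    have hθ2 : θ ≤ 2 := by
      rw [hθ, div_le_iff₀ (by positivity)]
      linarith
    have e1 : a - q * (H / n) = a * (1 - θ) := by
      rw [ha, hθ]
      field_simp
    have hz : θ * phi x ^ 2 / 4 ≤ 1 - (x + (a - q * (H / n)) * phi x) := by
      rw [e1]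
      have haφ0 : 0 ≤ a * phi x := by positivity
      rcases le_total θ 1 with h | h
      · nlinarith [mul_nonneg (sub_nonneg.2 h) (sub_nonneg.2 haφ), mul_nonneg hθ0.le (sub_nonneg.2 hφ2)]
      · nlinarith [mul_nonneg (sub_nonneg.2 h) haφ0, mul_nonneg (sub_nonneg.2 hθ2) (sq_nonneg (phi x))]
    have hmθ : 2 ≤ m ^ 2 * θ := by
      have h1 : (k * n / q : ℝ) ≤ m ^ 2 := (Real.sqrt_le_left (by positivity)).1 hcut
      calc (2 : ℝ) = k * n / q * θ := by
            rw [hθ]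
            field_simp
        _ ≤ _ := by gcongr
    have h7 : phi x / m / 2 ≤ √(1 - (x + (a - q * (H / n)) * phi x)) := by
      apply Real.le_sqrt_of_sq_le
      refine le_trans ?_ hz
      rw [div_pow, div_pow, div_div, div_le_div_iff₀ (by positivity) (by positivity)]
      nlinarith [mul_le_mul_of_nonneg_left hmθ (sq_nonneg (phi x)), sq_nonneg (phi x)]
    linarith [hvle (x + (a - q * (H / n)) * phi x)]

lemma one_le_cutSize {k n q : ℕ} (hn : 1 ≤ n) (hq : q ≤ k * n) : 1 ≤ cutSize k n q := by
  unfold cutSize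
  split_ifs with h
  · exact_mod_cast hn
  · rw [Real.one_le_sqrt, one_le_div (by positivity)]
    exact_mod_cast hq

lemma sum_cutSize_rev (k n : ℕ) :
    ∑ j : Fin k → Fin n, cutSize k n (∑ i, ((j i).rev : ℕ)) ^ k =
      ∑ j : Fin k → Fin n, cutSize k n (∑ i, (j i : ℕ)) ^ k :=
  (Equiv.arrowCongr (Equiv.refl (Fin k)) (Fin.revPerm (n := n))).sum_comp
    fun j => cutSize k n (∑ i, (j i : ℕ)) ^ k

/-- The constant produced by the decomposition of a difference into admissible ones. -/
noncomputable def splitConst (k : ℕ) : ℝ :=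
  2 ^ (k + 1) * (1 + (2 * √(2 * k)) ^ k) * (65 * k ^ 2) ^ k

/-- Each of the `n^k` blocks is cut finely enough for both ends of the stencil; `Q j` and `R j`
count the small steps to the lower and the upper end. -/
lemma eLpNorm_wdiff_le {k : ℕ} (hk : 1 ≤ k) (r : ℕ) {q t : ℝ} (hq : 1 ≤ q) (ht : 0 < t)
    (ht1 : t ≤ 1) {F : ℝ → ℝ} (hF : Measurable F) {H L : ℝ} (hH : 0 ≤ H) (hL : 1 ≤ L)
    (hHL : H ≤ L * t) :
    eLpNorm (wdiff k r H F) (ENNReal.ofReal q) (volume.restrict (dom (k * H / 2))) ≤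
      ENNReal.ofReal (splitConst k * L ^ k) *
        (blockConst k r * modulus k r (ENNReal.ofReal q) F t) := by
  have hk1 : (1 : ℝ) ≤ k := by exact_mod_cast hk
  set n : ℕ := ⌈64 * k ^ 2 * L⌉₊ with hn
  have hpos : 1 ≤ 64 * k ^ 2 * L := by
    calc (1 : ℝ) ≤ 64 * 1 ^ 2 * 1 := by norm_num
      _ ≤ _ := by gcongr
  have hnle : 64 * k ^ 2 * L ≤ n := Nat.le_ceil _
  have hn1' : (1 : ℝ) ≤ n := hpos.trans hnle
  have hn1 : 1 ≤ n := by exact_mod_cast hn1'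
  have hnup : (n : ℝ) ≤ 65 * k ^ 2 * L := by
    have h1 := (Nat.ceil_lt_add_one (show 0 ≤ 64 * k ^ 2 * L by linarith)).le
    have h2 : 1 ≤ k ^ 2 * L := by
      calc (1 : ℝ) = 1 ^ 2 * 1 := by norm_num
        _ ≤ _ := by gcongr
    linarith
  have hHn : H / n ≤ t / (64 * k ^ 2) := by
    rw [div_le_div_iff₀ (by linarith) (by positivity)]
    calc H * (64 * k ^ 2) ≤ L * t * (64 * k ^ 2) := by gcongr
      _ = t * (64 * k ^ 2 * L) := by ring
      _ ≤ t * n := by gcongr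
  set Q : (Fin k → Fin n) → ℕ := fun j => ∑ i, (j i : ℕ) with hQ
  set R : (Fin k → Fin n) → ℕ := fun j => ∑ i, ((j i).rev : ℕ) with hR
  have hQle : ∀ j, Q j ≤ k * n := fun j => by
    have h1 := sum_fin_le j
    have : (Q j : ℝ) ≤ k * n := by linarith
    exact_mod_cast this
  have hRle : ∀ j, R j ≤ k * n := fun j => hQle fun i => (j i).rev
  have hQR : ∀ j, (Q j : ℝ) + R j + k = k * n := by
    intro j
    have : Q j + R j + k = k * n := by
      have h1 : ∀ i, (j i : ℕ) + ((j i).rev : ℕ) + 1 = n := fun i => by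
        rw [Fin.val_rev]
        omega
      have h2 : ∑ i, ((j i : ℕ) + ((j i).rev : ℕ) + 1) = ∑ _i : Fin k, n :=
        Finset.sum_congr rfl fun i _ => h1 i
      simpa [Finset.sum_add_distrib, hQ, hR] using h2
    exact_mod_cast this
  -- Both cut sizes are at least 1, so rounding up at most doubles. This and the two ends account
  -- for the factor `2^(k+1)` in `splitConst`.
  set m : (Fin k → Fin n) → ℕ := fun j => ⌈max (cutSize k n (Q j)) (cutSize k n (R j))⌉₊ with hm
  have hmle : ∀ j, max (cutSize k n (Q j)) (cutSize k n (R j)) ≤ m j := fun j => Nat.le_ceil _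
  have hmax1 : ∀ j, 1 ≤ max (cutSize k n (Q j)) (cutSize k n (R j)) := fun j =>
    (one_le_cutSize hn1 (hQle j)).trans (le_max_left _ _)
  have hm1 : ∀ j, 1 ≤ m j := fun j => by exact_mod_cast (hmax1 j).trans (hmle j)
  have hmk : ∀ j, (m j : ℝ) ^ k ≤
      2 ^ k * (cutSize k n (Q j) ^ k + cutSize k n (R j) ^ k) := by
    intro j
    have h1 := (Nat.ceil_lt_add_one (show 0 ≤ max (cutSize k n (Q j)) (cutSize k n (R j)) by
      linarith [hmax1 j])).le
    have h2 : (m j : ℝ) ≤ 2 * max (cutSize k n (Q j)) (cutSize k n (R j)) := by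
      linarith [hmax1 j]
    refine (pow_le_pow_left₀ (Nat.cast_nonneg _) h2 k).trans ?_
    rw [mul_pow]
    gcongr
    have h3 : 0 ≤ cutSize k n (Q j) := by linarith [one_le_cutSize hn1 (hQle j)]
    have h4 : 0 ≤ cutSize k n (R j) := by linarith [one_le_cutSize hn1 (hRle j)]
    rcases max_choice (cutSize k n (Q j)) (cutSize k n (R j)) with h | h <;> rw [h]
    · linarith [pow_nonneg h4 k]
    · linarith [pow_nonneg h3 k]
  have hsum : ∑ j, (m j : ℝ) ^ k ≤ splitConst k * L ^ k := by
    refine (Finset.sum_le_sum fun j _ => hmk j).trans ?_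
    rw [← Finset.mul_sum, Finset.sum_add_distrib, hR, sum_cutSize_rev]
    have h1 := sum_cutSize_pow_le hk n
    have h2 : (n : ℝ) ^ k ≤ (65 * k ^ 2) ^ k * L ^ k := by
      rw [← mul_pow]
      gcongr
    calc _ ≤ 2 ^ k * ((1 + (2 * √(2 * k)) ^ k) * (n : ℝ) ^ k +
          (1 + (2 * √(2 * k)) ^ k) * (n : ℝ) ^ k) := by gcongr
      _ = 2 ^ (k + 1) * (1 + (2 * √(2 * k)) ^ k) * (n : ℝ) ^ k := by ring
      _ ≤ 2 ^ (k + 1) * (1 + (2 * √(2 * k)) ^ k) * ((65 * k ^ 2) ^ k * L ^ k) := by gcongr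
      _ = _ := by
        rw [splitConst]
        ring
  have e : wdiff k r H F = block k r H (-(k * H / 2)) H F := by
    ext x
    rw [wdiff, block]
    congr 2
    ring
  rw [e, block_subdivide k r H _ H F hn1]
  refine (eLpNorm_sum_le (fun j _ => (measurable_block k r H _ _ hF).aestronglyMeasurable)
    (by simpa using hq)).trans ?_
  refine (Finset.sum_le_sum (g := fun j => (m j : ℝ≥0∞) ^ k * (blockConst k r *
    modulus k r (ENNReal.ofReal q) F t)) fun j _ => ?_).trans ?_
  · change eLpNorm (block k r H (-(k * H / 2) + (Q j : ℝ) * (H / n)) (H / n) F) _ _ ≤ _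
    have hN0 : 0 ≤ H / n := by positivity
    have e1 : -(-(k * H / 2) + (Q j : ℝ) * (H / n)) = k * H / 2 - Q j * (H / n) := by ring
    have e2 : -(k * H / 2) + (Q j : ℝ) * (H / n) + k * (H / n) =
        k * H / 2 - R j * (H / n) := by
      have h1 : (Q j : ℝ) + k = k * n - R j := by linarith [hQR j]
      have h2 : (n : ℝ) * (H / n) = H := by field_simp
      calc _ = -(k * H / 2) + ((Q j : ℝ) + k) * (H / n) := by ring
        _ = -(k * H / 2) + k * (n * (H / n)) - R j * (H / n) := by
          rw [h1]
          ring
        _ = _ := by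
          rw [h2]
          ring
    have hb : ∀ s : ℕ, s ≤ k * n → |k * H / 2 - s * (H / n)| ≤ k * H / 2 := by
      intro s hs
      have h1 : (s : ℝ) ≤ k * n := by exact_mod_cast hs
      have h2 : (s : ℝ) * (H / n) ≤ k * n * (H / n) := by gcongr
      have h3 : (k : ℝ) * n * (H / n) = k * H := by field_simp
      have h4 : 0 ≤ (s : ℝ) * (H / n) := by positivity
      rw [abs_le]
      constructor <;> linarith
    refine eLpNorm_subdivided_block_le hk r hq ht ht1 hF hN0 ?_ ?_ (hm1 j) ?_ ?_
    · rw [← abs_neg, e1]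
      exact hb _ (hQle j)
    · rw [e2]
      exact hb _ (hRle j)
    · intro x hx
      rw [e2]
      exact stepOK_of_cutSize_le hk ht hH hn1 (hm1 j) hHn (hRle j)
        ((le_max_right _ _).trans (hmle j)) hx
    · intro x hx
      rw [e1]
      exact stepOK_of_cutSize_le hk ht hH hn1 (hm1 j) hHn (hQle j)
        ((le_max_left _ _).trans (hmle j)) hx
  · rw [← Finset.sum_mul]
    gcongr
    refine le_trans (le_of_eq ?_) (ENNReal.ofReal_le_ofReal hsum)
    rw [ENNReal.ofReal_sum_of_nonneg fun j _ => by positivity]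
    refine Finset.sum_congr rfl fun j _ => ?_
    rw [ENNReal.ofReal_pow (by positivity), ENNReal.ofReal_natCast]

/-! ### Large `t`, and the exponent `∞`. -/

lemma modulus_mono (k r : ℕ) (p : ℝ≥0∞) (F : ℝ → ℝ) {s t : ℝ} (h : s ≤ t) :
    modulus k r p F s ≤ modulus k r p F t :=
  biSup_mono fun _ hh => ⟨hh.1, hh.2.trans h⟩

/-- Unless the domain is empty, `H ≤ 2`, whence `H ≤ 2L min(t, 1)`, and the case `t ≤ 1` applies
with `2L`. -/
lemma eLpNorm_wdiff_le_modulus {k : ℕ} (hk : 1 ≤ k) (r : ℕ) {q t : ℝ} (hq : 1 ≤ q) (ht : 0 < t)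
    {F : ℝ → ℝ} (hF : Measurable F) {H L : ℝ} (hH : 0 ≤ H) (hL : 1 ≤ L) (hHL : H ≤ L * t) :
    eLpNorm (wdiff k r H F) (ENNReal.ofReal q) (volume.restrict (dom (k * H / 2))) ≤
      ENNReal.ofReal (splitConst k * (2 * L) ^ k) *
        (blockConst k r * modulus k r (ENNReal.ofReal q) F t) := by
  have hk1 : (1 : ℝ) ≤ k := by exact_mod_cast hk
  rcases (dom (k * H / 2)).eq_empty_or_nonempty with h | ⟨x, hx⟩
  · simp [h]
  have h1 := dom_one_le (by positivity) hx
  have hH2 : H ≤ 2 := by nlinarith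
  have hmin : H ≤ 2 * L * min t 1 := by
    rcases le_total t 1 with h | h
    · rw [min_eq_left h]
      nlinarith
    · rw [min_eq_right h]
      linarith
  refine (eLpNorm_wdiff_le hk r hq (lt_min ht one_pos) (min_le_right _ _) hF hH (by linarith)
    hmin).trans ?_
  gcongr
  exact modulus_mono k r _ F (min_le_left _ _)

/-- For `c > B`, Chebyshev's inequality bounds the measure of `{|g| ≥ c}` by `(B/c)^q`, which tends
to 0. -/
lemma eLpNorm_top_le {α : Type*} [MeasurableSpace α] {μ : Measure α} {g : α → ℝ}
    (hg : AEStronglyMeasurable g μ) {B : ℝ≥0∞}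
    (h : ∀ q : ℝ, 1 ≤ q → eLpNorm g (ENNReal.ofReal q) μ ≤ B) : eLpNorm g ⊤ μ ≤ B := by
  by_contra! hB
  obtain ⟨c, hBc, hc⟩ := exists_between hB
  have hct : c ≠ ⊤ := (hc.trans_le le_top).ne
  have hc0 : c ≠ 0 := (zero_le.trans_lt hBc).ne'
  have hS : μ {x | c ≤ ‖g x‖ₑ} ≠ 0 := by
    intro h0
    have : eLpNorm g ⊤ μ ≤ c := by
      rw [eLpNorm_exponent_top]
      refine eLpNormEssSup_le_of_ae_enorm_bound ?_
      rw [ae_iff]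
      refine measure_mono_null (fun x hx => ?_) h0
      exact (not_le.1 hx).le
    exact absurd hc (not_lt.2 this)
  have hn : ∀ n : ℕ, μ {x | c ≤ ‖g x‖ₑ} ≤ (B / c) ^ (n + 1) := by
    intro n
    have h1 := mul_meas_ge_le_pow_eLpNorm' μ (p := ENNReal.ofReal ((n + 1 : ℕ) : ℝ))
      (by simp; positivity) (by simp) hg c
    rw [ENNReal.toReal_ofReal (by positivity), ENNReal.rpow_natCast, ENNReal.rpow_natCast] at h1
    have h2 : c ^ (n + 1) * μ {x | c ≤ ‖g x‖ₑ} ≤ B ^ (n + 1) := by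
      refine h1.trans ?_
      gcongr
      exact h _ (by push_cast; linarith [(Nat.cast_nonneg n : (0 : ℝ) ≤ n)])
    rw [ENNReal.div_eq_inv_mul, mul_pow, ← ENNReal.inv_pow, ← ENNReal.div_eq_inv_mul,
      ENNReal.le_div_iff_mul_le (Or.inl (by simp [hc0])) (Or.inl (by simp [hct])), mul_comm]
    exact h2
  have hlt : B / c < 1 := by
    rw [ENNReal.div_lt_iff (Or.inl hc0) (Or.inl hct), one_mul]
    exact hBc
  have hlim := (ENNReal.tendsto_pow_atTop_nhds_zero_of_lt_one hlt).comp
    (Filter.tendsto_add_atTop_nat 1)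
  exact hS (le_antisymm (ge_of_tendsto' hlim hn) zero_le)

/-- Hölder on a set of measure at most 2, with `2^(1/q) ≤ 2` to keep the constant independent of
`q`. -/
lemma modulus_le_modulus_top {k : ℕ} (hk : 1 ≤ k) (r : ℕ) {q : ℝ} (hq : 1 ≤ q) {F : ℝ → ℝ}
    (hF : Measurable F) (t : ℝ) :
    modulus k r (ENNReal.ofReal q) F t ≤ 2 * modulus k r ⊤ F t := by
  rw [modulus_eq hk, modulus_eq hk]
  refine iSup₂_le fun h hh => ?_
  have hq0 : 0 < q := by linarith
  have h1 := eLpNorm_le_eLpNorm_mul_rpow_measure_univ (p := ENNReal.ofReal q) (q := ⊤)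
    (μ := volume.restrict (dom (k * h / 2))) le_top
    (measurable_wdiff k r h hF).aestronglyMeasurable
  have h2 : (volume.restrict (dom (k * h / 2)) Set.univ) ^
      (1 / (ENNReal.ofReal q).toReal - 1 / (⊤ : ℝ≥0∞).toReal) ≤ 2 := by
    rw [ENNReal.toReal_ofReal hq0.le, ENNReal.toReal_top, div_zero, sub_zero,
      Measure.restrict_apply_univ]
    have h3 : volume (dom (k * h / 2)) ≤ 2 := by
      refine (measure_mono (dom_subset _)).trans ?_
      rw [Real.volume_Icc]
      norm_num
    calc _ ≤ (2 : ℝ≥0∞) ^ (1 / q) := by gcongr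
      _ ≤ 2 ^ (1 : ℝ) := by
        refine ENNReal.rpow_le_rpow_of_exponent_le (by norm_num) ?_
        rw [div_le_one hq0]
        exact hq
      _ = 2 := ENNReal.rpow_one _
  refine h1.trans ?_
  rw [mul_comm]
  gcongr
  exact le_iSup₂_of_le (f := fun h (_ : h ∈ Set.Icc 0 t) =>
    eLpNorm (wdiff k r h F) ⊤ (volume.restrict (dom (k * h / 2)))) h hh le_rfl

lemma modulus_mul_le {k : ℕ} (hk : 1 ≤ k) (r : ℕ) {p : ℝ≥0∞} (hp : 1 ≤ p) {t : ℝ} (ht : 0 < t)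
    {F : ℝ → ℝ} (hF : Measurable F) {L : ℝ} (hL : 1 ≤ L) :
    modulus k r p F (L * t) ≤ ENNReal.ofReal (splitConst k * (2 * L) ^ k) *
      (blockConst k r * (2 * modulus k r p F t)) := by
  rw [modulus_eq hk r p F (L * t)]
  refine iSup₂_le fun H hH => ?_
  rcases eq_or_ne p ⊤ with rfl | hpt
  · refine eLpNorm_top_le (measurable_wdiff k r H hF).aestronglyMeasurable fun q hq => ?_
    refine (eLpNorm_wdiff_le_modulus hk r hq ht hF hH.1 hL hH.2).trans ?_
    gcongr
    exact modulus_le_modulus_top hk r hq hF t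
  · have e : p = ENNReal.ofReal p.toReal := (ENNReal.ofReal_toReal hpt).symm
    have hq : 1 ≤ p.toReal := by
      rw [e] at hp
      simpa using hp
    rw [e]
    refine (eLpNorm_wdiff_le_modulus hk r hq ht hF hH.1 hL hH.2).trans ?_
    gcongr
    rw [two_mul]
    exact le_self_add

/-- For `r = 0` a representative must be chosen; for `r ≥ 1` the function is a `deriv`, which is
always measurable. -/
lemma exists_measurable_of_memB {p : ℝ≥0∞} {r : ℕ} {f : ℝ → ℝ} (hf : MemB p r f) :
    ∃ F : ℝ → ℝ, Measurable F ∧ iteratedDeriv r f =ᵐ[leb] F ∧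
      MemLp (fun x => F x * phi x ^ r) p leb := by
  cases r with
  | zero =>
    have hf' : MemLp f p leb := hf
    refine ⟨hf'.1.mk f, hf'.1.stronglyMeasurable_mk.measurable, ?_, ?_⟩
    · rw [iteratedDeriv_zero]
      exact hf'.1.ae_eq_mk
    · simpa using hf'.ae_eq hf'.1.ae_eq_mk
  | succ r =>
    refine ⟨iteratedDeriv (r + 1) f, ?_, Filter.EventuallyEq.rfl, hf.2.2⟩
    rw [iteratedDeriv_succ]
    exact measurable_deriv _

end DTModulus

theorem mainTheorem9 (k : ℕ) (hk : 1 ≤ k) (r : ℕ) (p : ℝ≥0∞) (hp : 1 ≤ p) :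
    ∃ c : ℝ, 0 < c ∧ ∀ f : ℝ → ℝ, DTModulus.MemB p r f →
      ∀ lam : ℝ, 1 ≤ lam → ∀ t : ℝ, 0 < t →
        DTModulus.modulus k r p (iteratedDeriv r f) t < ⊤ ∧
        DTModulus.modulus k r p (iteratedDeriv r f) (lam * t) ≤
          ENNReal.ofReal (c * lam ^ k) * DTModulus.modulus k r p (iteratedDeriv r f) t := by
  have hk0 : (0 : ℝ) < k := by exact_mod_cast hk
  have hb : DTModulus.blockConst k r ≠ ⊤ := by
    unfold DTModulus.blockConst
    finiteness
  have hb0 : DTModulus.blockConst k r ≠ 0 := by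
    unfold DTModulus.blockConst
    have : (k : ℝ≥0∞) ≠ 0 := by exact_mod_cast (show k ≠ 0 by omega)
    simp [this]
  have hs : 0 < DTModulus.splitConst k := by
    unfold DTModulus.splitConst
    positivity
  refine ⟨DTModulus.splitConst k * 2 ^ k * (DTModulus.blockConst k r).toReal * 2,
    by have := ENNReal.toReal_pos hb0 hb; positivity, fun f hf lam hlam t ht => ?_⟩
  obtain ⟨F, hF, hfF, hFp⟩ := DTModulus.exists_measurable_of_memB hf
  rw [DTModulus.modulus_congr hk r p hfF, DTModulus.modulus_congr hk r p hfF]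
  refine ⟨DTModulus.modulus_lt_top hk r hp hF hFp t, ?_⟩
  refine (DTModulus.modulus_mul_le hk r hp ht hF hlam).trans (le_of_eq ?_)
  have e : DTModulus.splitConst k * 2 ^ k * (DTModulus.blockConst k r).toReal * 2 * lam ^ k =
      DTModulus.splitConst k * (2 * lam) ^ k * (DTModulus.blockConst k r).toReal * 2 := by ring
  rw [e, ENNReal.ofReal_mul (q := 2) (by positivity),
    ENNReal.ofReal_mul (q := (DTModulus.blockConst k r).toReal) (by positivity),
    ENNReal.ofReal_toReal hb, ENNReal.ofReal_ofNat]
  ring
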